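/- Let $d\ge 1$ and let $\Omega\subset\mathbb{R}^d$ be a bounded domain (nonempty, open, connected) satisfying the interior cone condition: for some $r>0$ and $\kappa\in(0,1)$, every $x\in\Omega$ admits a unit vector $\xi$ such that $x+y\in\Omega$ for all $y$ with $|y|\le r$ and $\kappa|y|\le \xi\cdot y$ (for instance, any bounded Lipschitz domain). Let either $p=1$ ($d$ arbitrary), or $p=2$ and $d\le 2$. Let $\alpha>0$, let $u_t\in L^p(\Omega)$, and let $u\in L^1_{\mathrm{loc}}(\Omega)$ have a weak gradient $\nabla u\in L^\infty(\Omega)^d$ whose components $\partial_{x_1}u,\dots,\partial_{x_d}u$ are linearly independent as elements of $L^\infty(\Omega)$. For $v\in L^1(\Omega)^d$ put $$\mathrm{TV}(v)=\sup\Big\{\int_\Omega \sum_{i=1}^d v_i\,\sum_{j=1}^d\partial_{x_j}\varphi_{ij}\,dx \;:\; \varphi\in C_c^\infty(\Omega;\mathbb{R}^{d\times d}),\ \|\varphi(x)\|_*\le 1 \text{ for all } x\Big\},$$ where $\|\cdot\|_*$ is one of the norms $\big(\sum_{i,j}A_{ij}^2\big)^{1/2}$ (isotropic TV), $\max_i\big(\sum_j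 A_{ij}^2\big)^{1/2}$ (componentwise isotropic TV), $\max_{i,j}|A_{ij}|$ (anisotropic TV), and let $BV(\Omega)^d$ be the set of $v\in L^1(\Omega)^d$ with $\mathrm{TV}(v)<\infty$ (the same set for all three choices). Then the $L^p$-TV optical flow functional $$J(v)=\frac1p\int_\Omega |u_t+\nabla u\cdot v|^p\,dx+\alpha\,\mathrm{TV}(v)$$ has a minimizer over $BV(\Omega)^d$: there is $v\in BV(\Omega)^d$ with $J(v)\le J(w)$ for all $w\in BV(\Omega)^d$. -/

import Mathlib

open MeasureTheory Set
open scoped ENNReal ContDiff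

noncomputable section

namespace OpticalFlow

/-- The `j`-th partial derivative of a scalar function on `ℝ^d`. -/
def partialDeriv {d : ℕ} (j : Fin d) (f : EuclideanSpace ℝ (Fin d) → ℝ)
    (x : EuclideanSpace ℝ (Fin d)) : ℝ :=
  fderiv ℝ f x (EuclideanSpace.single j 1)

/-- `ψ ∈ C_c^∞(Ω)`: smooth on `ℝ^d`, with compact support contained in `Ω`. -/
def IsTestFunction {d : ℕ} (Ω : Set (EuclideanSpace ℝ (Fin d)))
    (ψ : EuclideanSpace ℝ (Fin d) → ℝ) : Prop :=
  ContDiff ℝ ∞ ψ ∧ HasCompactSupport ψ ∧ tsupport ψ ⊆ Ω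

/-- `G` is the weak gradient of `u` on the open set `Ω`: both are locally integrable on `Ω` and
`∫_Ω u ∂_j ψ = - ∫_Ω (G)_j ψ` for all `ψ ∈ C_c^∞(Ω)` and all `j`. -/
def HasWeakGradient {d : ℕ} (Ω : Set (EuclideanSpace ℝ (Fin d)))
    (u : EuclideanSpace ℝ (Fin d) → ℝ)
    (G : EuclideanSpace ℝ (Fin d) → EuclideanSpace ℝ (Fin d)) : Prop :=
  LocallyIntegrableOn u Ω volume ∧ LocallyIntegrableOn G Ω volume ∧
    ∀ ψ : EuclideanSpace ℝ (Fin d) → ℝ, IsTestFunction Ω ψ → ∀ j : Fin d,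
      ∫ x in Ω, u x * partialDeriv j ψ x = - ∫ x in Ω, G x j * ψ x

/-- The interior cone condition: there is a finite closed cone (of height parameter `r` and with
half-angle `arccos κ ∈ (0, π/2)`) such that every `x ∈ Ω` is the vertex of a congruent copy,
with axis direction `ξ`, that lies in `Ω`. -/
def ConeCondition {d : ℕ} (Ω : Set (EuclideanSpace ℝ (Fin d))) : Prop :=
  ∃ r κ : ℝ, 0 < r ∧ 0 < κ ∧ κ < 1 ∧ ∀ x ∈ Ω, ∃ ξ : EuclideanSpace ℝ (Fin d), ‖ξ‖ = 1 ∧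
    ∀ y : EuclideanSpace ℝ (Fin d), ‖y‖ ≤ r → κ * ‖y‖ ≤ inner ℝ ξ y → x + y ∈ Ω

/-- The usual ways to measure the matrix `Dv = (∂_j v_i)_{i,j}` pointwise in the total variation of
a vector field: by `(∑_{i,j} |∂_j v_i|²)^{1/2}` (fully isotropic), by
`∑_i (∑_j |∂_j v_i|²)^{1/2}` (isotropic in each component), or by `∑_{i,j} |∂_j v_i|`
(anisotropic). -/
inductive TVVariant where
  | isotropic
  | componentwise
  | anisotropic

/-- `A` lies in the closed unit ball of the norm dual to the one selected by the variant. -/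
def TVVariant.DualBall {d : ℕ} : TVVariant → (Fin d → Fin d → ℝ) → Prop
  | .isotropic, A => ∑ i, ∑ j, A i j ^ 2 ≤ 1
  | .componentwise, A => ∀ i, ∑ j, A i j ^ 2 ≤ 1
  | .anisotropic, A => ∀ i j, |A i j| ≤ 1

/-- Admissible dual fields: `φ = (φ_{ij}) ∈ C_c^∞(Ω; ℝ^{d×d})`, pointwise in the dual unit ball. -/
def IsDualField {d : ℕ} (s : TVVariant) (Ω : Set (EuclideanSpace ℝ (Fin d)))
    (φ : Fin d → Fin d → EuclideanSpace ℝ (Fin d) → ℝ) : Prop :=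
  (∀ i j, IsTestFunction Ω (φ i j)) ∧ ∀ x, s.DualBall (fun i j => φ i j x)

/-- The total variation on `Ω` of a vector field `v`, in duality form:
`TV(v) = sup { ∫_Ω ∑_i v_i div φ_i }` over the admissible dual fields `φ`; meaningful for
`v ∈ L¹_loc(Ω)`. (The supremum is nonnegative because `φ = 0` is admissible.) -/
def totalVariation {d : ℕ} (s : TVVariant) (Ω : Set (EuclideanSpace ℝ (Fin d)))
    (v : EuclideanSpace ℝ (Fin d) → EuclideanSpace ℝ (Fin d)) : ℝ≥0∞ :=
  ⨆ (φ : Fin d → Fin d → EuclideanSpace ℝ (Fin d) → ℝ) (_ : IsDualField s Ω φ),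
    ENNReal.ofReal (∫ x in Ω, ∑ i, v x i * ∑ j, partialDeriv j (φ i j) x)

/-- `v ∈ BV(Ω)^d`: `v` is integrable on `Ω` and has finite total variation. (The three variants of
the total variation are equivalent, so the choice of one here is immaterial.) -/
def MemBV {d : ℕ} (Ω : Set (EuclideanSpace ℝ (Fin d)))
    (v : EuclideanSpace ℝ (Fin d) → EuclideanSpace ℝ (Fin d)) : Prop :=
  MemLp v 1 (volume.restrict Ω) ∧ totalVariation .isotropic Ω v < ⊤

/-- The `L^p`-TV optical flow functional
`(1/p) ‖u_t + ∇u · v‖_{L^p(Ω)}^p + α TV(v)`, where `ut` is `u_t` and `G` is `∇u`. -/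
def lpTVEnergy {d : ℕ} (p : ℕ) (s : TVVariant) (α : ℝ) (Ω : Set (EuclideanSpace ℝ (Fin d)))
    (ut : EuclideanSpace ℝ (Fin d) → ℝ)
    (G v : EuclideanSpace ℝ (Fin d) → EuclideanSpace ℝ (Fin d)) : ℝ≥0∞ :=
  (∫⁻ x in Ω, ‖ut x + inner ℝ (G x) (v x)‖ₑ ^ p) / (p : ℝ≥0∞)
    + ENNReal.ofReal α * totalVariation s Ω v

end OpticalFlow

end

/-!
The proof is the direct method of the calculus of variations, carried out in duality form: the
variation of a function is only ever tested against smooth fields, so that no structure theory of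
`BV` functions is needed. Since the dual unit ball of the isotropic total variation is the smallest
of the three, bounds for any variant give isotropic bounds, and from there bounds for the
components (`HasVariationBound`).

*Transport.* For the affine flow `x ↦ x + t (h - c x)` and a test function `ψ`, the integral of `f`
against the density transported from `ψ` has a time derivative of the form `-∫ f div φ` with an
admissible `φ`. The mean value inequality and duality bound `f - f ∘ (flow at time 1)` in `L¹` by
the variation of `f` (`HasVariationBound.lintegral_sub_flow_le`). Two cases are used: translations
(`c = 0`), and contractions onto midpoints (`c = 1/2`).

*Poincaré inequality.* Passing from `x` to `y` through the midpoint bounds `∫_A ∫_B |f x - f y|` by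
the variation whenever the segments between `A` and `B` stay in `Ω`
(`oscillationControlled_of_segment_subset`). The cone condition makes `Ω` a finite union of open
sets that are star-shaped with respect to balls (`ConeCondition.exists_finite_starShaped_cover`),
and connectedness links these balls, so that the estimate holds with `A = B = Ω`
(`oscillationControlled_self`).

*Coercivity.* By the Poincaré inequality the `L¹` distance of a field to some constant `c` is at
most a multiple of its variation, and linear independence of the components of `G = ∇u` makes
`c ↦ ∫_Ω |G · c|` a norm; hence the energy bounds the `L¹` norm
(`exists_lintegral_le_of_dataTerm_le`).

*Compactness.* The translation estimate shows that a field of bounded variation is close to its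
averages over small balls, away from the boundary. Weighting Lebesgue measure by the distance to
the boundary turns this into total boundedness in `L¹`
(`totallyBounded_setOf_isBVBounded`), so that a minimizing sequence has a subsequence converging
almost everywhere and against test functions (`exists_subseq_tendsto_of_isBVBounded`). The data
term is lower semicontinuous along it by Fatou's lemma, and the total variation as a supremum of
continuous functionals (`lpTVEnergy_le_liminf`).
-/

namespace OpticalFlow

open Filter Topology

/-! ### Test functions and the duality formula for the `L¹` norm -/

theorem IsTestFunction.partialDeriv_eq_zero {d : ℕ} {Ω : Set (EuclideanSpace ℝ (Fin d))}
    {ψ : EuclideanSpace ℝ (Fin d) → ℝ} (hψ : IsTestFunction Ω ψ) (j : Fin d)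
    {x : EuclideanSpace ℝ (Fin d)} (hx : x ∉ Ω) : partialDeriv j ψ x = 0 := by
  have : fderiv ℝ ψ x = 0 := by
    by_contra h
    exact hx (hψ.2.2 (support_fderiv_subset ℝ h))
  simp [partialDeriv, this]

theorem IsTestFunction.partialDeriv {d : ℕ} {Ω : Set (EuclideanSpace ℝ (Fin d))}
    {ψ : EuclideanSpace ℝ (Fin d) → ℝ} (hψ : IsTestFunction Ω ψ) (j : Fin d) :
    IsTestFunction Ω (partialDeriv j ψ) := by
  refine ⟨?_, ?_, ?_⟩
  · exact (hψ.1.fderiv_right (m := ∞) (by simp)).clm_apply contDiff_const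
  · exact hψ.2.1.fderiv_apply (𝕜 := ℝ) _
  · refine (closure_minimal ?_ (isClosed_tsupport ψ)).trans hψ.2.2
    intro x hx
    by_contra h
    apply hx
    have : fderiv ℝ ψ x = 0 := by
      by_contra h'
      exact h (support_fderiv_subset ℝ h')
    simp [OpticalFlow.partialDeriv, this]

theorem IsTestFunction.mul_left {d : ℕ} {Ω : Set (EuclideanSpace ℝ (Fin d))}
    {ψ a : EuclideanSpace ℝ (Fin d) → ℝ} (hψ : IsTestFunction Ω ψ) (ha : ContDiff ℝ ∞ a) :
    IsTestFunction Ω (fun x => ψ x * a x) :=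
  ⟨hψ.1.mul ha, hψ.2.1.mul_right, tsupport_mul_subset_left.trans hψ.2.2⟩

theorem IsTestFunction.exists_bound {d : ℕ} {Ω : Set (EuclideanSpace ℝ (Fin d))}
    {ψ : EuclideanSpace ℝ (Fin d) → ℝ} (hψ : IsTestFunction Ω ψ) : ∃ C, ∀ x, |ψ x| ≤ C :=
  hψ.2.1.exists_bound_of_continuous hψ.1.continuous

theorem exists_testFunction_eq_one {d : ℕ} {W K : Set (EuclideanSpace ℝ (Fin d))}
    (hW : IsOpen W) (hK : IsCompact K) (hKW : K ⊆ W) :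
    ∃ χ : EuclideanSpace ℝ (Fin d) → ℝ, IsTestFunction W χ ∧ (∀ x, χ x ∈ Icc (0 : ℝ) 1) ∧
      ∀ x ∈ K, χ x = 1 := by
  obtain ⟨V, hVo, hKV, hVW, hVc⟩ := exists_open_between_and_isCompact_closure hK hW hKW
  obtain ⟨f, hf, hr, hs, h1⟩ := exists_contMDiff_support_eq_eq_one_iff
    (modelWithCornersSelf ℝ (EuclideanSpace ℝ (Fin d))) hVo hK.isClosed hKV
  refine ⟨f, ⟨hf.contDiff, ?_, ?_⟩, fun x => hr ⟨x, rfl⟩, fun x hx => (h1 x).1 hx⟩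
  · rw [HasCompactSupport, tsupport, hs]
    exact hVc
  · rw [tsupport, hs]
    exact hVW

theorem sq_div_sqrt_ge {q δ : ℝ} (hδ : 0 < δ) : |q| - δ ≤ q * (q / √(q ^ 2 + δ ^ 2)) := by
  have h0 : 0 < √(q ^ 2 + δ ^ 2) := Real.sqrt_pos.2 (by positivity)
  rw [← mul_div_assoc, le_div_iff₀ h0]
  rcases le_or_gt |q| δ with h | h
  · nlinarith [mul_self_nonneg q]
  · have h2 : √(q ^ 2 + δ ^ 2) ≤ |q| + δ := by
      rw [Real.sqrt_le_left (by positivity)]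
      nlinarith [sq_abs q, abs_nonneg q]
    nlinarith [sq_abs q]

theorem abs_div_sqrt_le_one {q δ : ℝ} : |q / √(q ^ 2 + δ ^ 2)| ≤ 1 := by
  rw [abs_div, abs_of_nonneg (Real.sqrt_nonneg _)]
  exact div_le_one_of_le₀ (Real.abs_le_sqrt (by nlinarith [sq_nonneg δ])) (Real.sqrt_nonneg _)

/-- The `L¹` norm of `g` on `W` is the supremum of `∫ g ψ` over test functions `|ψ| ≤ 1`. Near
optimal test functions are `χ q / √(q² + δ²)`, with `χ` a cutoff and `q` a smooth approximation
of `g`: they approximate the sign of `g`. -/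
theorem lintegral_enorm_le_of_forall_testFunction {d : ℕ} {W : Set (EuclideanSpace ℝ (Fin d))}
    (hW : IsOpen W) (hWb : Bornology.IsBounded W) {g : EuclideanSpace ℝ (Fin d) → ℝ}
    (hg : Integrable g) {M : ℝ}
    (h : ∀ ψ, IsTestFunction W ψ → (∀ x, |ψ x| ≤ 1) → ∫ x, g x * ψ x ≤ M) :
    ∫⁻ x in W, ‖g x‖ₑ ≤ ENNReal.ofReal M := by
  have hWfin : volume W ≠ ⊤ := hWb.measure_lt_top.ne
  have key : ∀ K : Set (EuclideanSpace ℝ (Fin d)), IsCompact K → K ⊆ W →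
      ∫⁻ x in K, ‖g x‖ₑ ≤ ENNReal.ofReal M := by
    intro K hK hKW
    rw [← ofReal_integral_norm_eq_lintegral_enorm hg.integrableOn]
    apply ENNReal.ofReal_le_ofReal
    refine le_of_forall_pos_le_add fun ε hε => ?_
    set δ : ℝ := ε / (2 + volume.real W) with hδdef
    have hv : 0 < 2 + volume.real W := by positivity
    have hδ : 0 < δ := by positivity
    obtain ⟨q, hqc, hqs, hq⟩ := (memLp_one_iff_integrable.2 hg).exist_eLpNorm_sub_le
      ENNReal.one_ne_top le_rfl hδ
    have hqi : Integrable q := hqs.continuous.integrable_of_hasCompactSupport hqc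
    have hgq : Integrable (g - q) := hg.sub hqi
    have hq' : ∫ x, ‖g x - q x‖ ≤ δ := by
      rw [eLpNorm_one_eq_lintegral_enorm, ← ofReal_integral_norm_eq_lintegral_enorm hgq,
        ENNReal.ofReal_le_ofReal_iff hδ.le] at hq
      exact hq
    obtain ⟨χ, hχ, hχ01, hχ1⟩ := exists_testFunction_eq_one hW hK hKW
    set r : EuclideanSpace ℝ (Fin d) → ℝ := fun x => q x / √(q x ^ 2 + δ ^ 2) with hr
    have hrs : ContDiff ℝ ∞ r := by
      refine hqs.div (ContDiff.sqrt (by fun_prop) fun x => by positivity) fun x => ?_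
      exact (Real.sqrt_pos.2 (by positivity)).ne'
    have hψ : IsTestFunction W (fun x => χ x * r x) :=
      ⟨hχ.1.mul hrs, hχ.2.1.mul_right, (tsupport_mul_subset_left).trans hχ.2.2⟩
    have hψ1 : ∀ x, |χ x * r x| ≤ 1 := by
      intro x
      rw [abs_mul, abs_of_nonneg (hχ01 x).1]
      exact mul_le_one₀ (hχ01 x).2 (abs_nonneg _) abs_div_sqrt_le_one
    have hM := h _ hψ hψ1
    have hψi : Integrable (fun x => g x * (χ x * r x)) :=
      hg.mul_bdd (c := 1) hψ.1.continuous.aestronglyMeasurable (ae_of_all _ hψ1)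
    have hWi : Integrable (W.indicator fun _ => δ) :=
      (integrable_indicator_iff hW.measurableSet).2 (integrableOn_const hWfin)
    -- Since `q ψ ≥ χ (|q| - δ)`, the product `g ψ` nearly dominates `|g|` on `K` and is nearly
    -- nonnegative on the rest of `W`.
    have hpt : ∀ x, K.indicator (fun x => ‖g x‖) x ≤
        g x * (χ x * r x) + 2 * ‖g x - q x‖ + W.indicator (fun _ => δ) x := by
      intro x
      have h1 : -|g x - q x| ≤ (g x - q x) * (χ x * r x) := by
        refine neg_le_of_abs_le ?_
        rw [abs_mul]
        exact mul_le_of_le_one_right (abs_nonneg _) (hψ1 x)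
      have h2 := sq_div_sqrt_ge (q := q x) hδ
      have h3 : |g x| ≤ |q x| + |g x - q x| := by
        have := abs_add_le (q x) (g x - q x)
        simpa using this
      have h4 : χ x * (|q x| - δ) ≤ q x * (χ x * r x) := by
        have := mul_le_mul_of_nonneg_left h2 (hχ01 x).1
        calc _ ≤ _ := this
          _ = _ := by simp only [hr]; ring
      by_cases hxK : x ∈ K
      · rw [indicator_of_mem hxK, indicator_of_mem (hKW hxK)]
        rw [hχ1 x hxK] at h4 h1 ⊢
        simp only [Real.norm_eq_abs]
        linarith
      · rw [indicator_of_notMem hxK]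
        by_cases hxW : x ∈ W
        · rw [indicator_of_mem hxW]
          simp only [Real.norm_eq_abs]
          have := mul_nonneg (hχ01 x).1 (abs_nonneg (q x))
          have := mul_le_mul_of_nonneg_right (hχ01 x).2 hδ.le
          nlinarith [abs_nonneg (g x - q x)]
        · have : χ x = 0 := image_eq_zero_of_notMem_tsupport fun hx => hxW (hχ.2.2 hx)
          rw [indicator_of_notMem hxW, this]
          simp
    calc ∫ x in K, ‖g x‖ = ∫ x, K.indicator (fun x => ‖g x‖) x :=
          (integral_indicator hK.measurableSet).symm
      _ ≤ ∫ x, (g x * (χ x * r x) + 2 * ‖g x - q x‖ + W.indicator (fun _ => δ) x) := by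
          refine integral_mono ((integrable_indicator_iff hK.measurableSet).2
            hg.norm.integrableOn) ((hψi.add (hgq.norm.const_mul 2)).add hWi) hpt
      _ = (∫ x, g x * (χ x * r x)) + 2 * (∫ x, ‖g x - q x‖) + volume.real W * δ := by
          have h2 : Integrable (fun x => 2 * ‖g x - q x‖) := hgq.norm.const_mul 2
          have h12 : Integrable (fun x => g x * (χ x * r x) + 2 * ‖g x - q x‖) := hψi.add h2
          rw [integral_add h12 hWi, integral_add hψi h2, integral_const_mul,
            integral_indicator hW.measurableSet, setIntegral_const, smul_eq_mul]
      _ ≤ M + 2 * δ + volume.real W * δ := by gcongr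
      _ = M + ε := by rw [hδdef]; field_simp; ring
  obtain ⟨F, hFc, hFW, hFU, hFm⟩ := hW.exists_iUnion_isClosed
  rw [← hFU, setLIntegral_iUnion_of_directed _ hFm.directed_le]
  exact iSup_le fun n => key _ (Metric.isCompact_of_isClosed_isBounded (hFc n)
    (hWb.subset (hFW n))) (hFW n)

/-! ### Functions of bounded variation -/

/-- The distributional gradient of the scalar function `f` on `Ω` has total mass at most `M`:
the duality form of the variation, meaningful for `f` locally integrable on `Ω`. -/
def HasVariationBound {d : ℕ} (Ω : Set (EuclideanSpace ℝ (Fin d)))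
    (f : EuclideanSpace ℝ (Fin d) → ℝ) (M : ℝ) : Prop :=
  ∀ φ : Fin d → EuclideanSpace ℝ (Fin d) → ℝ, (∀ j, IsTestFunction Ω (φ j)) →
    (∀ x, ∑ j, φ j x ^ 2 ≤ 1) → ∫ x in Ω, f x * ∑ j, partialDeriv j (φ j) x ≤ M

theorem HasVariationBound.abs_integral_le {d : ℕ} {Ω : Set (EuclideanSpace ℝ (Fin d))}
    {f : EuclideanSpace ℝ (Fin d) → ℝ} {M : ℝ} (h : HasVariationBound Ω f M)
    {φ : Fin d → EuclideanSpace ℝ (Fin d) → ℝ} (hφ : ∀ j, IsTestFunction Ω (φ j)) {C : ℝ}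
    (hC : 0 < C) (hφC : ∀ x, ∑ j, φ j x ^ 2 ≤ C ^ 2) :
    |∫ x in Ω, f x * ∑ j, partialDeriv j (φ j) x| ≤ C * M := by
  have key : ∀ a : ℝ, a ^ 2 = C⁻¹ ^ 2 →
      a * ∫ x in Ω, f x * ∑ j, partialDeriv j (φ j) x ≤ M := by
    intro a ha
    have h1 := h (fun j x => φ j x * a) (fun j => (hφ j).mul_left contDiff_const) (by
      intro x
      simp_rw [mul_pow, ← Finset.sum_mul, ha, inv_pow]
      rw [← div_eq_mul_inv]
      exact div_le_one_of_le₀ (hφC x) (by positivity))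
    rw [← integral_const_mul]
    refine le_of_eq_of_le ?_ h1
    congr 1 with x
    have : ∀ j, partialDeriv j (fun x => φ j x * a) x = partialDeriv j (φ j) x * a := by
      intro j
      simp only [partialDeriv]
      rw [fderiv_mul_const ((hφ j).1.differentiable (by simp) x)]
      simp [mul_comm]
    simp_rw [this, ← Finset.sum_mul]
    ring
  have h1 := key C⁻¹ rfl
  have h2 := key (-C⁻¹) (by ring)
  rw [abs_le]
  constructor
  · have := mul_le_mul_of_nonneg_left h2 hC.le
    have e : C * (-C⁻¹ * ∫ x in Ω, f x * ∑ j, partialDeriv j (φ j) x) =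
      -∫ x in Ω, f x * ∑ j, partialDeriv j (φ j) x := by field_simp
    linarith
  · have := mul_le_mul_of_nonneg_left h1 hC.le
    have e : C * (C⁻¹ * ∫ x in Ω, f x * ∑ j, partialDeriv j (φ j) x) =
      ∫ x in Ω, f x * ∑ j, partialDeriv j (φ j) x := by field_simp
    linarith

/-! ### The transport estimate -/

/-- Up to the factor `-(1 - t c)^{-(d+1)}`, the time derivative of the density transported from `ψ`
by the flow `x ↦ x + t (h - c x)`, as a function of the starting point `x` of the trajectory. -/
noncomputable def transportRate {d : ℕ} (c : ℝ) (h : EuclideanSpace ℝ (Fin d))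
    (ψ : EuclideanSpace ℝ (Fin d) → ℝ) (x : EuclideanSpace ℝ (Fin d)) : ℝ :=
  fderiv ℝ ψ x (h - c • x) - c * d * ψ x

theorem continuous_transportRate {d : ℕ} (c : ℝ) (h : EuclideanSpace ℝ (Fin d))
    {ψ : EuclideanSpace ℝ (Fin d) → ℝ} (hψ : ContDiff ℝ ∞ ψ) :
    Continuous (transportRate c h ψ) := by
  have := hψ.continuous_fderiv (by simp)
  have := hψ.continuous
  unfold transportRate
  fun_prop

theorem exists_bound_transportRate {d : ℕ} (c : ℝ) (h : EuclideanSpace ℝ (Fin d))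
    {ψ : EuclideanSpace ℝ (Fin d) → ℝ} (hψ : ContDiff ℝ ∞ ψ) (hc : HasCompactSupport ψ) :
    ∃ C, ∀ x, |transportRate c h ψ x| ≤ C := by
  refine HasCompactSupport.exists_bound_of_continuous (hc.mono' ?_)
    (continuous_transportRate c h hψ)
  intro x hx
  by_contra h'
  apply hx
  have h1 : fderiv ℝ ψ x = 0 := by
    by_contra h2
    exact h' (support_fderiv_subset ℝ h2)
  simp [transportRate, h1, image_eq_zero_of_notMem_tsupport h']

theorem hasDerivAt_transportedDensity {d : ℕ} {c : ℝ} {h : EuclideanSpace ℝ (Fin d)}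
    {ψ : EuclideanSpace ℝ (Fin d) → ℝ} (hψ : ContDiff ℝ ∞ ψ) (z : EuclideanSpace ℝ (Fin d))
    {t : ℝ} (ht : 1 - t * c ≠ 0) :
    HasDerivAt (fun t : ℝ => (1 - t * c)⁻¹ ^ d * ψ ((1 - t * c)⁻¹ • (z - t • h)))
      (-((1 - t * c)⁻¹ ^ (d + 1) *
        transportRate c h ψ ((1 - t * c)⁻¹ • (z - t • h)))) t := by
  have hl : HasDerivAt (fun t : ℝ => (1 - t * c)⁻¹) (c * (1 - t * c)⁻¹ ^ 2) t := by
    refine (((hasDerivAt_id' t).mul_const c).const_sub 1).fun_inv ht |>.congr_deriv ?_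
    simp [div_eq_mul_inv]
  have hz : HasDerivAt (fun t : ℝ => z - t • h) (-h) t := by
    simpa using ((hasDerivAt_id t).smul_const h).const_sub z
  have hA := hl.smul hz
  have hψA := ((hψ.differentiable (by simp)
    ((1 - t * c)⁻¹ • (z - t • h))).hasFDerivAt).comp_hasDerivAt t hA
  have hp := (hl.pow d).mul hψA
  refine hp.congr_deriv ?_
  set l := (1 - t * c)⁻¹ with hldef
  set x := l • (z - t • h) with hx
  have e : l • (-h) + (c * l ^ 2) • (z - t • h) = (-l) • (h - c • x) := by
    rw [hx]; module
  change d * l ^ (d - 1) * (c * l ^ 2) * ψ x +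
    l ^ d * fderiv ℝ ψ x (l • (-h) + (c * l ^ 2) • (z - t • h)) = _
  rw [e, map_smul, transportRate, smul_eq_mul]
  rcases d with _ | d
  · simp
  · simp only [Nat.add_sub_cancel]
    push_cast
    ring

/-- The divergence of the transported density times the velocity field of the flow: up to sign it is
the time derivative in `hasDerivAt_transportedDensity` (continuity equation). -/
theorem partialDeriv_transportedField {d : ℕ} {c l : ℝ} {h w : EuclideanSpace ℝ (Fin d)}
    {ψ : EuclideanSpace ℝ (Fin d) → ℝ} (hψ : ContDiff ℝ ∞ ψ) (z : EuclideanSpace ℝ (Fin d)) :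
    ∑ j, partialDeriv j (fun z => l ^ d * (ψ (l • (z - w)) * (h - c • (l • (z - w))) j)) z =
      l ^ (d + 1) * transportRate c h ψ (l • (z - w)) := by
  have hA : HasFDerivAt (fun z : EuclideanSpace ℝ (Fin d) => l • (z - w))
      (l • ContinuousLinearMap.id ℝ _) z := ((hasFDerivAt_id z).sub_const w).const_smul l
  have hψA := ((hψ.differentiable (by simp) (l • (z - w))).hasFDerivAt).comp z hA
  set x := l • (z - w) with hx
  have hj : ∀ j : Fin d,
      partialDeriv j (fun z => l ^ d * (ψ (l • (z - w)) * (h - c • (l • (z - w))) j)) z =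
      l ^ (d + 1) * (fderiv ℝ ψ x ((h - c • x) j • EuclideanSpace.single j 1) - c * ψ x) := by
    intro j
    have hV : HasFDerivAt (fun z : EuclideanSpace ℝ (Fin d) => (h - c • (l • (z - w))) j)
        (-((c * l) • (EuclideanSpace.proj j : EuclideanSpace ℝ (Fin d) →L[ℝ] ℝ))) z := by
      have h1 := ((EuclideanSpace.proj (𝕜 := ℝ) j).hasFDerivAt (x := h - c • x)).comp z
        ((hA.const_smul c).const_sub h)
      refine h1.congr_fderiv ?_
      ext y
      simp [mul_assoc]
    have := ((hψA.mul hV).const_mul (l ^ d)).fderiv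
    have e : (fun z => l ^ d * (ψ (l • (z - w)) * (h - c • (l • (z - w))) j)) =
      (fun y => l ^ d *
        (((ψ ∘ fun z => l • (z - w)) * fun z => (h - c • l • (z - w)).ofLp j) y)) := rfl
    rw [partialDeriv, e, this, map_smul]
    simp [← hx]
    ring
  simp_rw [hj]
  rw [← Finset.mul_sum, Finset.sum_sub_distrib, ← map_sum, transportRate]
  congr 3
  · ext i
    simp [Finset.sum_apply, Pi.single_apply]
  · simp; ring

/-- The integral of `f ∈ L¹` against the transported density may be differentiated in time under the
integral sign. -/
theorem hasDerivAt_integral_transportedDensity {d : ℕ}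
    {f : EuclideanSpace ℝ (Fin d) → ℝ} (hf : Integrable f)
    {c : ℝ} {h : EuclideanSpace ℝ (Fin d)} (hc0 : 0 ≤ c) (hc : c ≤ 1 / 2)
    {ψ : EuclideanSpace ℝ (Fin d) → ℝ} (hψ : ContDiff ℝ ∞ ψ) (hψc : HasCompactSupport ψ)
    {t : ℝ} (ht1 : t ≤ 1) :
    HasDerivAt (fun t : ℝ => ∫ z, f z * ((1 - t * c)⁻¹ ^ d * ψ ((1 - t * c)⁻¹ • (z - t • h))))
      (∫ z, f z * -((1 - t * c)⁻¹ ^ (d + 1) *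
        transportRate c h ψ ((1 - t * c)⁻¹ • (z - t • h)))) t := by
  -- On this neighbourhood of `t` the contraction factor `1 - s c` stays away from `0`.
  have hl : ∀ s ∈ Metric.ball t (1 / 2 : ℝ), 1 / 4 ≤ 1 - s * c := by
    intro s hs
    rw [Metric.mem_ball, Real.dist_eq, abs_lt] at hs
    have : s * c ≤ 3 / 2 * c := mul_le_mul_of_nonneg_right (by linarith) hc0
    linarith
  have hinv : ∀ s ∈ Metric.ball t (1 / 2 : ℝ), |(1 - s * c)⁻¹| ≤ 4 := by
    intro s hs
    have h4 := hl s hs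
    rw [abs_of_nonneg (by positivity), inv_le_comm₀ (by linarith) (by norm_num)]
    linarith
  have hball := Metric.ball_mem_nhds t (show (0 : ℝ) < 1 / 2 by norm_num)
  obtain ⟨C, hC⟩ := exists_bound_transportRate c h hψ hψc
  obtain ⟨C', hC'⟩ := hψc.exists_bound_of_continuous hψ.continuous
  have hψcont := hψ.continuous
  have hrcont := continuous_transportRate c h hψ
  refine (hasDerivAt_integral_of_dominated_loc_of_deriv_le
    (F' := fun t z => f z * -((1 - t * c)⁻¹ ^ (d + 1) *
        transportRate c h ψ ((1 - t * c)⁻¹ • (z - t • h))))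
    (bound := fun z => ‖f z‖ * (4 ^ (d + 1) * C)) hball ?_ ?_ ?_ ?_ ?_ ?_).2
  · refine Eventually.of_forall fun s => hf.aestronglyMeasurable.mul ?_
    exact (by fun_prop : Continuous fun z : EuclideanSpace ℝ (Fin d) =>
      (1 - s * c)⁻¹ ^ d * ψ ((1 - s * c)⁻¹ • (z - s • h))).aestronglyMeasurable
  · refine hf.mul_bdd (c := |(1 - t * c)⁻¹ ^ d| * C') (by fun_prop : Continuous
      fun z : EuclideanSpace ℝ (Fin d) =>
      (1 - t * c)⁻¹ ^ d * ψ ((1 - t * c)⁻¹ • (z - t • h))).aestronglyMeasurable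
      (ae_of_all _ fun z => ?_)
    rw [norm_mul, Real.norm_eq_abs]
    exact mul_le_mul_of_nonneg_left (hC' _) (abs_nonneg _)
  · exact hf.aestronglyMeasurable.mul (by fun_prop : Continuous
      fun z : EuclideanSpace ℝ (Fin d) => -((1 - t * c)⁻¹ ^ (d + 1) *
        transportRate c h ψ ((1 - t * c)⁻¹ • (z - t • h)))).aestronglyMeasurable
  · refine ae_of_all _ fun z s hs => ?_
    rw [norm_mul, norm_neg, norm_mul, Real.norm_eq_abs, Real.norm_eq_abs, abs_pow]
    gcongr
    · exact hinv s hs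
    · exact hC _
  · exact hf.norm.mul_const _
  · refine ae_of_all _ fun z s hs => ?_
    exact (hasDerivAt_transportedDensity hψ z (by linarith [hl s hs])).const_mul (f z)

/-- Transport estimate: moving the argument of `f` along the affine flow `x ↦ x + t (h - c x)`,
`0 ≤ t ≤ 1`, costs in `L¹(W)` at most a multiple of the variation of `f`. The case `c = 0` is the
translation by `h`, the case `c = 1/2` the contraction towards the point `2 h` onto midpoints. -/
theorem HasVariationBound.lintegral_sub_flow_le {d : ℕ} {Ω W : Set (EuclideanSpace ℝ (Fin d))}
    {f : EuclideanSpace ℝ (Fin d) → ℝ} {M : ℝ} (hM : HasVariationBound Ω f M)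
    (hf : Integrable f) (hW : IsOpen W) (hWb : Bornology.IsBounded W)
    {c R : ℝ} {h : EuclideanSpace ℝ (Fin d)} (hc0 : 0 ≤ c) (hc : c ≤ 1 / 2) (hR : 0 < R)
    (hVR : ∀ x ∈ W, ‖h - c • x‖ ≤ R)
    (hflow : ∀ x ∈ W, ∀ t ∈ Icc (0 : ℝ) 1, x + t • (h - c • x) ∈ Ω) :
    ∫⁻ x in W, ‖f x - f (x + (h - c • x))‖ₑ ≤ ENNReal.ofReal (2 ^ d * R * M) := by
  have hlp : 0 < 1 - c := by linarith
  have hT : ∀ x : EuclideanSpace ℝ (Fin d), x + (h - c • x) = (1 - c) • x + h := fun x => by module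
  have hfT : Integrable (fun x => f (x + (h - c • x))) := by
    simp_rw [hT]
    exact (hf.comp_add_right h).comp_smul hlp.ne'
  refine lintegral_enorm_le_of_forall_testFunction hW hWb (hf.sub hfT) ?_
  intro ψ hψ hψ1
  set ρ : ℝ → ℝ := fun t =>
    ∫ z, f z * ((1 - t * c)⁻¹ ^ d * ψ ((1 - t * c)⁻¹ • (z - t • h))) with hρ
  have hψf : Integrable (fun x => f x * ψ x) :=
    hf.mul_bdd (c := 1) hψ.1.continuous.aestronglyMeasurable (ae_of_all _ hψ1)
  have hψfT : Integrable (fun x => f (x + (h - c • x)) * ψ x) :=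
    hfT.mul_bdd (c := 1) hψ.1.continuous.aestronglyMeasurable (ae_of_all _ hψ1)
  have hρ0 : ρ 0 = ∫ x, f x * ψ x := by simp [hρ]
  -- Substituting `z = x + (h - c x)` turns the transported density back into `ψ`.
  have hρ1 : ρ 1 = ∫ x, f (x + (h - c • x)) * ψ x := by
    simp only [hρ, one_mul, one_smul, hT]
    have e1 := integral_sub_right_eq_self (μ := volume) (fun z : EuclideanSpace ℝ (Fin d) =>
      f (z + h) * ((1 - c)⁻¹ ^ d * ψ ((1 - c)⁻¹ • z))) h
    have e2 := Measure.integral_comp_inv_smul_of_nonneg volume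
      (fun x : EuclideanSpace ℝ (Fin d) => f ((1 - c) • x + h) * ((1 - c)⁻¹ ^ d * ψ x)) hlp.le
    simp only [sub_add_cancel] at e1
    simp only [smul_inv_smul₀ hlp.ne', finrank_euclideanSpace_fin] at e2
    rw [e1, e2, smul_eq_mul, ← integral_const_mul]
    congr 1 with x
    have hpow : (1 - c) ^ d * (1 - c)⁻¹ ^ d = 1 := by
      rw [← mul_pow, mul_inv_cancel₀ hlp.ne', one_pow]
    linear_combination (f ((1 - c) • x + h) * ψ x) * hpow
  have hbound : ‖ρ 1 - ρ 0‖ ≤ 2 ^ d * R * M := by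
    refine norm_image_sub_le_of_norm_deriv_le_segment_01' (fun t ht =>
      (hasDerivAt_integral_transportedDensity hf hc0 hc hψ.1 hψ.2.1
        ht.2).hasDerivWithinAt) ?_
    intro t ht
    have htc : t * c ≤ 1 / 2 := by
      calc t * c ≤ 1 * c := mul_le_mul_of_nonneg_right ht.2.le hc0
        _ ≤ 1 / 2 := by linarith
    set l := (1 - t * c)⁻¹ with hl
    have hl0 : 0 < l := inv_pos.2 (by linarith)
    have hl2 : l ≤ 2 := by
      rw [hl, inv_le_comm₀ (by linarith) (by norm_num)]
      linarith
    set φ : Fin d → EuclideanSpace ℝ (Fin d) → ℝ := fun j z =>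
      l ^ d * (ψ (l • (z - t • h)) * (h - c • (l • (z - t • h))) j) with hφdef
    -- The flow maps `W` into `Ω`, so the density transported from `ψ` is supported in `Ω`.
    have hback : ∀ z, l • (z - t • h) ∈ W → z ∈ Ω := by
      intro z hz
      have h1 := hflow _ hz t ⟨ht.1, ht.2.le⟩
      have h2 : l • (z - t • h) + t • (h - c • (l • (z - t • h))) =
        ((1 - t * c) * l) • (z - t • h) + t • h := by module
      have h3 : (1 - t * c) * l = 1 := mul_inv_cancel₀ (by linarith)
      rw [h2, h3] at h1
      simpa using h1
    have hψA : IsTestFunction Ω (fun z => ψ (l • (z - t • h))) := by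
      refine ⟨hψ.1.comp (by fun_prop), ?_, ?_⟩
      · exact hψ.2.1.comp_homeomorph
          ((Homeomorph.subRight (t • h)).trans (Homeomorph.smulOfNeZero l hl0.ne'))
      · have : tsupport (fun z => ψ (l • (z - t • h))) ⊆
            (fun z => l • (z - t • h)) ⁻¹' tsupport ψ := by
          refine closure_minimal (fun z hz => subset_tsupport ψ hz)
            ((isClosed_tsupport ψ).preimage (by fun_prop))
        exact fun z hz => hback z (hψ.2.2 (this hz))
    have hφ : ∀ j, IsTestFunction Ω (φ j) := by
      intro j
      have := (hψA.mul_left (a := fun z => (h - c • (l • (z - t • h))) j)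
        (by
          have : ContDiff ℝ ∞
              (fun z : EuclideanSpace ℝ (Fin d) => h - c • (l • (z - t • h))) := by fun_prop
          exact (EuclideanSpace.proj (𝕜 := ℝ) j).contDiff.comp this)).mul_left
        (a := fun _ => l ^ d) contDiff_const
      simpa only [hφdef, mul_comm (l ^ d)] using this
    have hφb : ∀ x, ∑ j, φ j x ^ 2 ≤ (2 ^ d * R) ^ 2 := by
      intro x
      simp only [hφdef]
      set y := l • (x - t • h)
      have e : ∑ j, (l ^ d * (ψ y * (h - c • y) j)) ^ 2 = (l ^ d * (|ψ y| * ‖h - c • y‖)) ^ 2 := by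
        rw [mul_pow, mul_pow, EuclideanSpace.norm_sq_eq, Finset.mul_sum, Finset.mul_sum]
        simp [mul_pow]
      rw [e]
      by_cases hy : y ∈ W
      · have := hψ1 y
        have := hVR y hy
        have h1 : |ψ y| * ‖h - c • y‖ ≤ 1 * R := by gcongr
        rw [one_mul] at h1
        gcongr
      · have : ψ y = 0 := image_eq_zero_of_notMem_tsupport fun hx => hy (hψ.2.2 hx)
        rw [this]
        simp
        positivity
    -- The divergence of `φ` is minus the time derivative of the transported density.
    have key := hM.abs_integral_le hφ (by positivity) hφb
    refine le_of_eq_of_le ?_ key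
    rw [Real.norm_eq_abs, ← abs_neg, ← integral_neg,
      setIntegral_eq_integral_of_forall_compl_eq_zero]
    · congr 2 with z
      rw [partialDeriv_transportedField hψ.1]
      ring
    · intro x hx
      rw [Finset.sum_eq_zero fun j _ => (hφ j).partialDeriv_eq_zero j hx, mul_zero]
  calc ∫ x, (f - fun x => f (x + (h - c • x))) x * ψ x = ρ 0 - ρ 1 := by
        rw [hρ0, hρ1, ← integral_sub hψf hψfT]
        congr 1 with x
        simp [sub_mul]
    _ ≤ ‖ρ 1 - ρ 0‖ := by
        rw [Real.norm_eq_abs, abs_sub_comm]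
        exact le_abs_self _
    _ ≤ _ := hbound

/-! ### The Poincaré inequality under the cone condition -/

section

/-- The oscillation of functions between the sets `A` and `B` is controlled by their variation on
`Ω`, with a constant that does not depend on the function. -/
def OscillationControlled {d : ℕ} (Ω A B : Set (EuclideanSpace ℝ (Fin d))) : Prop :=
  ∃ C : ℝ≥0∞, C ≠ ⊤ ∧ ∀ (f : EuclideanSpace ℝ (Fin d) → ℝ) (M : ℝ), Measurable f → Integrable f →
    HasVariationBound Ω f M →
      ∫⁻ x in A, ∫⁻ y in B, ‖f x - f y‖ₑ ≤ C * ENNReal.ofReal M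

variable {d : ℕ} {Ω A B D : Set (EuclideanSpace ℝ (Fin d))}

theorem OscillationControlled.mono (h : OscillationControlled Ω A B)
    {A' B' : Set (EuclideanSpace ℝ (Fin d))} (hA : A' ⊆ A) (hB : B' ⊆ B) :
    OscillationControlled Ω A' B' := by
  obtain ⟨C, hC, h⟩ := h
  refine ⟨C, hC, fun f M hfm hf hM => (le_trans ?_ (h f M hfm hf hM))⟩
  exact (lintegral_mono fun x => lintegral_mono_set hB).trans (lintegral_mono_set hA)

theorem OscillationControlled.symm (h : OscillationControlled Ω A B) :
    OscillationControlled Ω B A := by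
  obtain ⟨C, hC, h⟩ := h
  refine ⟨C, hC, fun f M hfm hf hM => (le_of_eq_of_le ?_ (h f M hfm hf hM))⟩
  rw [lintegral_lintegral_swap]
  · simp_rw [fun x y => (edist_eq_enorm_sub (f x) (f y)).symm, fun x y => edist_comm (f x) (f y)]
  · exact Measurable.aemeasurable (by fun_prop)

theorem OscillationControlled.trans (h₁ : OscillationControlled Ω A B)
    (h₂ : OscillationControlled Ω B D) (hA : volume A ≠ ⊤) (hB : volume B ≠ ⊤)
    (hD : volume D ≠ ⊤) (hB0 : volume B ≠ 0) : OscillationControlled Ω A D := by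
  obtain ⟨C₁, hC₁, h₁⟩ := h₁
  obtain ⟨C₂, hC₂, h₂⟩ := h₂
  refine ⟨(volume B)⁻¹ * (volume D * C₁ + volume A * C₂), by finiteness,
    fun f M hfm hf hM => ?_⟩
  have key : volume B * ∫⁻ x in A, ∫⁻ z in D, ‖f x - f z‖ₑ ≤
      (volume D * C₁ + volume A * C₂) * ENNReal.ofReal M := by
    calc volume B * ∫⁻ x in A, ∫⁻ z in D, ‖f x - f z‖ₑ
        = ∫⁻ y in B, ∫⁻ x in A, ∫⁻ z in D, ‖f x - f z‖ₑ := by simp [mul_comm]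
      _ ≤ ∫⁻ y in B, ∫⁻ x in A, ∫⁻ z in D, (‖f x - f y‖ₑ + ‖f y - f z‖ₑ) := by
          refine lintegral_mono fun y => lintegral_mono fun x => lintegral_mono fun z => ?_
          simp only [← edist_eq_enorm_sub]
          exact edist_triangle _ _ _
      _ = ∫⁻ y in B, ∫⁻ x in A, (volume D * ‖f x - f y‖ₑ + ∫⁻ z in D, ‖f y - f z‖ₑ) := by
          simp_rw [lintegral_add_left measurable_const]
          simp [mul_comm]
      _ = (volume D * ∫⁻ y in B, ∫⁻ x in A, ‖f x - f y‖ₑ) +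
            volume A * ∫⁻ y in B, ∫⁻ z in D, ‖f y - f z‖ₑ := by
          rw [← lintegral_const_mul _ (by fun_prop), ← lintegral_const_mul _ (by fun_prop),
            ← lintegral_add_left (by fun_prop)]
          refine lintegral_congr fun y => ?_
          rw [lintegral_add_left (by fun_prop), lintegral_const_mul _ (by fun_prop)]
          simp [mul_comm]
      _ = (volume D * ∫⁻ x in A, ∫⁻ y in B, ‖f x - f y‖ₑ) +
            volume A * ∫⁻ y in B, ∫⁻ z in D, ‖f y - f z‖ₑ := by
          rw [lintegral_lintegral_swap (Measurable.aemeasurable (by fun_prop))]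
      _ ≤ volume D * (C₁ * ENNReal.ofReal M) + volume A * (C₂ * ENNReal.ofReal M) := by
          gcongr
          · exact h₁ f M hfm hf hM
          · exact h₂ f M hfm hf hM
      _ = _ := by ring
  calc _ = (volume B)⁻¹ * (volume B * ∫⁻ x in A, ∫⁻ z in D, ‖f x - f z‖ₑ) := by
        rw [← mul_assoc, ENNReal.inv_mul_cancel hB0 hB, one_mul]
    _ ≤ (volume B)⁻¹ * ((volume D * C₁ + volume A * C₂) * ENNReal.ofReal M) := by gcongr
    _ = _ := by ring

theorem OscillationControlled.biUnion {ι : Type*} {t : Set ι} (ht : t.Finite)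
    {S : ι → Set (EuclideanSpace ℝ (Fin d))} (h : ∀ i ∈ t, OscillationControlled Ω (S i) B) :
    OscillationControlled Ω (⋃ i ∈ t, S i) B := by
  induction t, ht using Set.Finite.induction_on with
  | empty => exact ⟨0, by simp, by simp⟩
  | @insert a s ha hs ih =>
    obtain ⟨C₁, hC₁, h₁⟩ := h a (mem_insert _ _)
    obtain ⟨C₂, hC₂, h₂⟩ := ih fun i hi => h i (mem_insert_of_mem _ hi)
    refine ⟨C₁ + C₂, by finiteness, fun f M hfm hf hM => ?_⟩
    rw [biUnion_insert, add_mul]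
    exact (lintegral_union_le _ _ _).trans (add_le_add (h₁ f M hfm hf hM) (h₂ f M hfm hf hM))

/-- If all segments between `A` and `B` lie in `Ω`, one passes from `x ∈ A` to `y ∈ B` through the
midpoint. Freezing `y`, the map from `x` to the midpoint contracts only by the factor `1/2`, and so
does the map from `y` with `x` frozen: the transport estimate applies to both halves. -/
theorem oscillationControlled_of_segment_subset (hA : IsOpen A) (hAb : Bornology.IsBounded A)
    (hB : IsOpen B) (hBb : Bornology.IsBounded B) (h : ∀ x ∈ A, ∀ y ∈ B, segment ℝ x y ⊆ Ω) :
    OscillationControlled Ω A B := by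
  obtain ⟨R, hR0, hR⟩ := (hAb.union hBb).exists_pos_norm_le
  have hAfin : volume A ≠ ⊤ := hAb.measure_lt_top.ne
  have hBfin : volume B ≠ ⊤ := hBb.measure_lt_top.ne
  refine ⟨(volume A + volume B) * ENNReal.ofReal (2 ^ d * R), by finiteness,
    fun f M hfm hf hM => ?_⟩
  have half : ∀ {A B : Set (EuclideanSpace ℝ (Fin d))}, IsOpen A → Bornology.IsBounded A →
      MeasurableSet B → (∀ x ∈ A, ‖x‖ ≤ R) → (∀ y ∈ B, ‖y‖ ≤ R) →
      (∀ x ∈ A, ∀ y ∈ B, segment ℝ x y ⊆ Ω) →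
      ∫⁻ y in B, ∫⁻ x in A, ‖f x - f (x + ((1 / 2 : ℝ) • y - (1 / 2 : ℝ) • x))‖ₑ ≤
        ENNReal.ofReal (2 ^ d * R * M) * volume B := by
    intro A B hA hAb hB hRA hRB h
    rw [← setLIntegral_const]
    refine setLIntegral_mono' hB fun y hy => ?_
    refine hM.lintegral_sub_flow_le hf hA hAb (by norm_num) le_rfl hR0 ?_ ?_
    · intro x hx
      rw [← smul_sub, norm_smul]
      have := norm_sub_le y x
      have := hRA x hx
      have := hRB y hy
      norm_num
      linarith
    · intro x hx t ht
      refine h x hx y hy ?_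
      rw [segment_eq_image']
      refine ⟨t / 2, ⟨by linarith [ht.1], by linarith [ht.2]⟩, ?_⟩
      simp only
      module
  have h1 := half hA hAb hB.measurableSet (fun x hx => hR x (Or.inl hx))
    (fun y hy => hR y (Or.inr hy)) h
  have h2 := half hB hBb hA.measurableSet (fun x hx => hR x (Or.inr hx))
    (fun y hy => hR y (Or.inl hy)) (fun y hy x hx => by rw [segment_symm]; exact h x hx y hy)
  calc ∫⁻ x in A, ∫⁻ y in B, ‖f x - f y‖ₑ
      ≤ ∫⁻ x in A, ∫⁻ y in B, (‖f x - f (x + ((1 / 2 : ℝ) • y - (1 / 2 : ℝ) • x))‖ₑ +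
          ‖f y - f (y + ((1 / 2 : ℝ) • x - (1 / 2 : ℝ) • y))‖ₑ) := by
        refine lintegral_mono fun x => lintegral_mono fun y => ?_
        have e : x + ((1 / 2 : ℝ) • y - (1 / 2 : ℝ) • x) =
          y + ((1 / 2 : ℝ) • x - (1 / 2 : ℝ) • y) := by module
        rw [← e]
        simp only [← edist_eq_enorm_sub]
        exact edist_triangle_right _ _ _
    _ = (∫⁻ y in B, ∫⁻ x in A, ‖f x - f (x + ((1 / 2 : ℝ) • y - (1 / 2 : ℝ) • x))‖ₑ) +
          ∫⁻ x in A, ∫⁻ y in B, ‖f y - f (y + ((1 / 2 : ℝ) • x - (1 / 2 : ℝ) • y))‖ₑ := by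
        rw [lintegral_lintegral_swap (μ := volume.restrict B)
          (Measurable.aemeasurable (by fun_prop)), ← lintegral_add_left (by fun_prop)]
        refine lintegral_congr fun x => ?_
        rw [lintegral_add_left (by fun_prop)]
    _ ≤ _ := add_le_add h1 h2
    _ = _ := by
        rw [ENNReal.ofReal_mul (by positivity)]
        ring

theorem isOpen_setOf_forall_segment_subset (hΩ : IsOpen Ω) (b : EuclideanSpace ℝ (Fin d)) (r : ℝ) :
    IsOpen {x | ∀ y ∈ Metric.closedBall b r, segment ℝ x y ⊆ Ω} := by
  rw [isOpen_iff_eventually]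
  intro x hx
  have hK : IsCompact (Metric.closedBall b r ×ˢ Icc (0 : ℝ) 1) :=
    (isCompact_closedBall b r).prod isCompact_Icc
  have := hK.eventually_forall_of_forall_eventually (x₀ := x)
    (P := fun x q => x + q.2 • (q.1 - x) ∈ Ω) (by
      rintro ⟨y, t⟩ ⟨hy, ht⟩
      have hc : Continuous fun z : EuclideanSpace ℝ (Fin d) × (EuclideanSpace ℝ (Fin d) × ℝ) =>
        z.1 + z.2.2 • (z.2.1 - z.1) := by fun_prop
      refine (hΩ.preimage hc).mem_nhds (hx y hy ?_)
      rw [segment_eq_image']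
      exact ⟨t, ht, rfl⟩)
  filter_upwards [this] with x' hx' y hy
  rw [segment_eq_image']
  rintro _ ⟨t, ht, rfl⟩
  exact hx' (y, t) ⟨hy, ht⟩

/-- Under the cone condition, `Ω` is a finite union of sets that are star-shaped in `Ω` with
respect to a closed ball: each `x ∈ Ω` sees a ball inside its cone, of a radius that does not depend
on `x`, and finitely many balls of half that radius suffice. -/
theorem ConeCondition.exists_finite_starShaped_cover (hcone : ConeCondition Ω)
    (hΩb : Bornology.IsBounded Ω) :
    ∃ ρ : ℝ, 0 < ρ ∧ ∃ t ⊆ Ω, t.Finite ∧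
      Ω ⊆ ⋃ b ∈ t, {x | ∀ y ∈ Metric.closedBall b ρ, segment ℝ x y ⊆ Ω} := by
  obtain ⟨r, κ, hr, hκ0, hκ1, hcone⟩ := hcone
  -- The ball of radius `δ` about `x + (r/2) ξ` lies in the cone at `x`, because
  -- `κ (r/2 + δ) ≤ r/2 - δ`.
  set δ := (1 - κ) * r / 4 with hδ
  have hδ0 : 0 < δ := by
    have : 0 < 1 - κ := by linarith
    positivity
  have hδr : δ ≤ r / 2 := by rw [hδ]; nlinarith
  have hδκ : κ * (r / 2 + δ) ≤ r / 2 - δ := by rw [hδ]; nlinarith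
  set Z := {z | ∃ x ∈ Ω, ∀ y ∈ Metric.closedBall z δ, segment ℝ x y ⊆ Ω} with hZ
  have hZΩ : Z ⊆ Ω := by
    rintro z ⟨x, -, hz⟩
    exact hz z (Metric.mem_closedBall_self hδ0.le) (right_mem_segment ℝ x z)
  have hseen : ∀ x ∈ Ω, ∃ z, ∀ y ∈ Metric.closedBall z δ, segment ℝ x y ⊆ Ω := by
    intro x hx
    obtain ⟨ξ, hξ, hcx⟩ := hcone x hx
    refine ⟨x + (r / 2) • ξ, fun y hy => ?_⟩
    rw [mem_closedBall_iff_norm] at hy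
    set e := y - (x + (r / 2) • ξ) with he
    have hye : y - x = (r / 2) • ξ + e := by rw [he]; module
    have hn : ‖(r / 2) • ξ + e‖ ≤ r / 2 + δ := by
      refine (norm_add_le _ _).trans (add_le_add ?_ hy)
      rw [norm_smul, hξ, Real.norm_eq_abs, abs_of_pos (by positivity), mul_one]
    have hi : r / 2 - δ ≤ inner ℝ ξ ((r / 2) • ξ + e) := by
      rw [inner_add_right, inner_smul_right, real_inner_self_eq_norm_sq, hξ]
      have := (abs_le.1 (abs_real_inner_le_norm ξ e)).1
      rw [hξ] at this
      linarith
    rw [segment_eq_image']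
    rintro _ ⟨s, hs, rfl⟩
    simp only [hye]
    refine hcx _ ?_ ?_
    · rw [norm_smul, Real.norm_eq_abs, abs_of_nonneg hs.1]
      calc s * _ ≤ 1 * (r / 2 + δ) := mul_le_mul hs.2 hn (norm_nonneg _) zero_le_one
        _ ≤ r := by linarith
    · rw [norm_smul, Real.norm_eq_abs, abs_of_nonneg hs.1, inner_smul_right]
      calc κ * (s * ‖(r / 2) • ξ + e‖) = s * (κ * ‖(r / 2) • ξ + e‖) := by ring
        _ ≤ s * (κ * (r / 2 + δ)) := by gcongr; exact hs.1
        _ ≤ s * (r / 2 - δ) := by gcongr; exact hs.1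
        _ ≤ _ := mul_le_mul_of_nonneg_left hi hs.1
  have htb : TotallyBounded Z :=
    (hΩb.subset hZΩ).isCompact_closure.totallyBounded.subset subset_closure
  obtain ⟨t, htZ, htf, ht⟩ := Metric.finite_approx_of_totallyBounded htb (δ / 2) (by positivity)
  refine ⟨δ / 2, by positivity, t, htZ.trans hZΩ, htf, fun x hx => ?_⟩
  obtain ⟨z, hz⟩ := hseen x hx
  obtain ⟨b, hbt, hzb⟩ := mem_iUnion₂.1 (ht ⟨x, hx, hz⟩)
  refine mem_iUnion₂.2 ⟨b, hbt, fun y hy => hz y ?_⟩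
  rw [Metric.mem_ball] at hzb
  rw [Metric.mem_closedBall] at hy ⊢
  calc dist y z ≤ dist y b + dist z b := dist_triangle_right _ _ _
    _ ≤ δ := by linarith

/-- Any two points of `Ω` have neighbourhoods between which the oscillation is controlled: this
holds within a small ball, and the relation is transitive. -/
theorem exists_oscillationControlled_nhds (hΩo : IsOpen Ω) (hΩc : IsConnected Ω)
    (hΩb : Bornology.IsBounded Ω) {x y : EuclideanSpace ℝ (Fin d)} (hx : x ∈ Ω) (hy : y ∈ Ω) :
    ∃ U V, IsOpen U ∧ IsOpen V ∧ U ⊆ Ω ∧ V ⊆ Ω ∧ x ∈ U ∧ y ∈ V ∧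
      OscillationControlled Ω U V := by
  have hfin : ∀ U ⊆ Ω, volume U ≠ ⊤ := fun U hU => (hΩb.subset hU).measure_lt_top.ne
  refine hΩc.isPreconnected.induction₂ (fun x y => ∃ U V, IsOpen U ∧ IsOpen V ∧ U ⊆ Ω ∧ V ⊆ Ω ∧
    x ∈ U ∧ y ∈ V ∧ OscillationControlled Ω U V) ?_ ?_ ?_ hx hy
  · intro x hx
    obtain ⟨r, hr, hb⟩ := Metric.isOpen_iff.1 hΩo x hx
    refine mem_nhdsWithin_of_mem_nhds ?_
    filter_upwards [Metric.ball_mem_nhds x hr] with y hy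
    refine ⟨_, _, Metric.isOpen_ball, Metric.isOpen_ball, hb, hb, Metric.mem_ball_self hr, hy, ?_⟩
    exact oscillationControlled_of_segment_subset Metric.isOpen_ball Metric.isBounded_ball
      Metric.isOpen_ball Metric.isBounded_ball
      fun a ha c hc => ((convex_ball x r).segment_subset ha hc).trans hb
  · rintro x y z - - - ⟨U, V, hU, hV, hUΩ, hVΩ, hxU, hyV, h⟩
      ⟨V', W, hV', hW, hVΩ', hWΩ, hyV', hzW, h'⟩
    -- The oscillations are compared through `V ∩ V'`, an open set that contains `y`.
    refine ⟨U, W, hU, hW, hUΩ, hWΩ, hxU, hzW, ?_⟩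
    exact (h.mono subset_rfl inter_subset_left).trans (h'.mono inter_subset_right subset_rfl)
      (hfin _ hUΩ) (hfin _ (inter_subset_left.trans hVΩ)) (hfin _ hWΩ)
      ((hV.inter hV').measure_pos volume ⟨y, hyV, hyV'⟩).ne'
  · rintro x y - - ⟨U, V, hU, hV, hUΩ, hVΩ, hxU, hyV, h⟩
    exact ⟨V, U, hV, hU, hVΩ, hUΩ, hyV, hxU, h.symm⟩

/-- **Poincaré inequality** on a bounded connected open set with the cone condition: two of the
star-shaped pieces are linked through their balls, and the balls along a path in `Ω`. -/
theorem oscillationControlled_self (hΩo : IsOpen Ω) (hΩc : IsConnected Ω)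
    (hΩb : Bornology.IsBounded Ω) (hcone : ConeCondition Ω) : OscillationControlled Ω Ω Ω := by
  obtain ⟨ρ, hρ, t, htΩ, htf, hcover⟩ := hcone.exists_finite_starShaped_cover hΩb
  set S : EuclideanSpace ℝ (Fin d) → Set (EuclideanSpace ℝ (Fin d)) :=
    fun b => {x | ∀ y ∈ Metric.closedBall b ρ, segment ℝ x y ⊆ Ω}
  have hSΩ : ∀ b, S b ⊆ Ω := fun b x hx =>
    hx b (Metric.mem_closedBall_self hρ.le) (left_mem_segment ℝ x b)
  have hfin : ∀ U ⊆ Ω, volume U ≠ ⊤ := fun U hU => (hΩb.subset hU).measure_lt_top.ne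
  have hSB : ∀ b, OscillationControlled Ω (S b) (Metric.ball b ρ) := fun b =>
    oscillationControlled_of_segment_subset (isOpen_setOf_forall_segment_subset hΩo b ρ)
      (hΩb.subset (hSΩ b)) Metric.isOpen_ball Metric.isBounded_ball
      fun x hx y hy => hx y (Metric.ball_subset_closedBall hy)
  have hSS : ∀ b ∈ t, ∀ b' ∈ t, OscillationControlled Ω (S b) (S b') := by
    intro b hb b' hb'
    obtain ⟨U, V, hU, hV, hUΩ, hVΩ, hbU, hbV, h⟩ :=
      exists_oscillationControlled_nhds hΩo hΩc hΩb (htΩ hb) (htΩ hb')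
    have hUV := h.mono (A' := U ∩ Metric.ball b ρ) (B' := V ∩ Metric.ball b' ρ)
      inter_subset_left inter_subset_left
    have h1 := (hSB b).mono (B' := U ∩ Metric.ball b ρ) subset_rfl inter_subset_right
    have h2 := (hSB b').mono (B' := V ∩ Metric.ball b' ρ) subset_rfl inter_subset_right
    have hUf := hfin (U ∩ Metric.ball b ρ) (inter_subset_left.trans hUΩ)
    have hVf := hfin (V ∩ Metric.ball b' ρ) (inter_subset_left.trans hVΩ)
    refine (h1.trans hUV (hfin _ (hSΩ b)) hUf hVf ?_).trans h2.symm (hfin _ (hSΩ b)) hVf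
      (hfin _ (hSΩ b')) ?_
    · exact ((hU.inter Metric.isOpen_ball).measure_pos volume
        ⟨b, hbU, Metric.mem_ball_self hρ⟩).ne'
    · exact ((hV.inter Metric.isOpen_ball).measure_pos volume
        ⟨b', hbV, Metric.mem_ball_self hρ⟩).ne'
  exact (OscillationControlled.biUnion htf fun b hb =>
    (OscillationControlled.biUnion htf fun b' hb' => hSS b' hb' b hb).symm).mono hcover hcover

end

/-! ### Approximation by averages over balls -/

section

theorem enorm_le_sum_enorm_apply {d : ℕ} (y : EuclideanSpace ℝ (Fin d)) :
    ‖y‖ₑ ≤ ∑ i, ‖y i‖ₑ := by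
  have h : ‖y‖ ≤ ∑ i, ‖y i‖ := by
    conv_lhs => rw [← (EuclideanSpace.basisFun (Fin d) ℝ).sum_repr y]
    refine (norm_sum_le _ _).trans (Finset.sum_le_sum fun i _ => ?_)
    simp [norm_smul]
  simp_rw [← ofReal_norm]
  rw [← ENNReal.ofReal_sum_of_nonneg fun i _ => norm_nonneg _]
  exact ENNReal.ofReal_le_ofReal h

/-- The ball of `BV(Ω)^d` with mass at most `C` and componentwise variation at most `M`; its
elements are represented by measurable functions that are integrable over the whole space. -/
structure IsBVBounded {d : ℕ} (Ω : Set (EuclideanSpace ℝ (Fin d))) (C M : ℝ)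
    (v : EuclideanSpace ℝ (Fin d) → EuclideanSpace ℝ (Fin d)) : Prop where
  measurable : Measurable v
  lintegral_le : ∫⁻ x, ‖v x‖ₑ ≤ ENNReal.ofReal C
  hasVariationBound : ∀ i, HasVariationBound Ω (fun x => v x i) M

variable {d : ℕ} {Ω W : Set (EuclideanSpace ℝ (Fin d))} {C M : ℝ}
  {v w : EuclideanSpace ℝ (Fin d) → EuclideanSpace ℝ (Fin d)}

theorem IsBVBounded.integrable (hv : IsBVBounded Ω C M v) : Integrable v :=
  ⟨hv.measurable.aestronglyMeasurable, hv.lintegral_le.trans_lt ENNReal.ofReal_lt_top⟩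

theorem IsBVBounded.lintegral_sub_translate_le (hv : IsBVBounded Ω C M v) (hW : IsOpen W)
    (hWb : Bornology.IsBounded W) {ε : ℝ} (hε : 0 < ε) (hWΩ : ∀ x ∈ W, Metric.ball x ε ⊆ Ω)
    {h : EuclideanSpace ℝ (Fin d)} (hh : ‖h‖ < ε) :
    ∫⁻ x in W, ‖v x - v (x + h)‖ₑ ≤ d * ENNReal.ofReal (2 ^ d * ε * M) := by
  have hm := hv.measurable
  calc ∫⁻ x in W, ‖v x - v (x + h)‖ₑ ≤ ∫⁻ x in W, ∑ i, ‖v x i - v (x + h) i‖ₑ :=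
        lintegral_mono fun x => enorm_le_sum_enorm_apply _
    _ = ∑ i, ∫⁻ x in W, ‖v x i - v (x + h) i‖ₑ := lintegral_finsetSum _ fun i _ => by fun_prop
    _ ≤ ∑ _i : Fin d, ENNReal.ofReal (2 ^ d * ε * M) := by
        refine Finset.sum_le_sum fun i _ => ?_
        have hvi : Integrable (fun x => v x i) :=
          (EuclideanSpace.proj (𝕜 := ℝ) i).integrable_comp hv.integrable
        have := (hv.hasVariationBound i).lintegral_sub_flow_le hvi hW hWb (c := 0) (h := h) le_rfl
          (by norm_num) hε (fun x _ => by simpa using hh.le) (fun x hx t ht => hWΩ x hx (by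
            rw [mem_ball_iff_norm, add_sub_cancel_left, zero_smul, sub_zero, norm_smul,
              Real.norm_eq_abs, abs_of_nonneg ht.1]
            exact (mul_le_of_le_one_left (norm_nonneg _) ht.2).trans_lt hh))
        simpa using this
    _ = _ := by simp

theorem IsBVBounded.lintegral_lintegral_ball_le (hv : IsBVBounded Ω C M v) (hW : IsOpen W)
    (hWb : Bornology.IsBounded W) {ε : ℝ} (hε : 0 < ε) (hWΩ : ∀ x ∈ W, Metric.ball x ε ⊆ Ω) :
    ∫⁻ x in W, ∫⁻ y in Metric.ball x ε, ‖v x - v y‖ₑ ≤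
      volume (Metric.ball (0 : EuclideanSpace ℝ (Fin d)) ε) *
        (d * ENNReal.ofReal (2 ^ d * ε * M)) := by
  have hm := hv.measurable
  have h1 : ∀ x, ∫⁻ y in Metric.ball x ε, ‖v x - v y‖ₑ =
      ∫⁻ h in Metric.ball 0 ε, ‖v x - v (x + h)‖ₑ := by
    intro x
    rw [← lintegral_indicator measurableSet_ball, ← lintegral_indicator measurableSet_ball,
      ← lintegral_add_left_eq_self _ x]
    congr 1 with h
    simp [indicator]
  simp_rw [h1]
  rw [lintegral_lintegral_swap (Measurable.aemeasurable (by fun_prop)), mul_comm,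
    ← setLIntegral_const]
  exact setLIntegral_mono' measurableSet_ball fun h hh =>
    hv.lintegral_sub_translate_le hW hWb hε hWΩ (by simpa using hh)

/-- Two fields of bounded variation whose integrals over finitely many small balls almost agree are
close in `L¹`: each of them is close to its averages over balls. -/
theorem IsBVBounded.lintegral_sub_le_of_integral_ball (hv : IsBVBounded Ω C M v)
    (hw : IsBVBounded Ω C M w) (hW : IsOpen W)
    (hWb : Bornology.IsBounded W) {ε η : ℝ} (hε : 0 < ε)
    (hWΩ : ∀ x ∈ W, Metric.ball x (2 * ε) ⊆ Ω) {t : Set (EuclideanSpace ℝ (Fin d))}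
    (ht : W ⊆ ⋃ p ∈ t, Metric.ball p ε)
    (hη : ∀ p ∈ t, ‖(∫ x in Metric.ball p ε, v x) - ∫ x in Metric.ball p ε, w x‖ ≤ η) :
    ∫⁻ x in W, ‖v x - w x‖ₑ ≤ 2 * 2 ^ d * d * ENNReal.ofReal (2 ^ d * (2 * ε) * M) +
      (volume (Metric.ball (0 : EuclideanSpace ℝ (Fin d)) ε))⁻¹ *
        (volume W * ENNReal.ofReal η) := by
  have hvm := hv.measurable
  have hwm := hw.measurable
  set B := volume (Metric.ball (0 : EuclideanSpace ℝ (Fin d)) ε) with hB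
  have hB0 : B ≠ 0 := (Metric.measure_ball_pos volume 0 hε).ne'
  have hBt : B ≠ ⊤ := measure_ball_lt_top.ne
  have hB2 : volume (Metric.ball (0 : EuclideanSpace ℝ (Fin d)) (2 * ε)) = 2 ^ d * B := by
    have := Measure.addHaar_ball_mul_of_pos volume (0 : EuclideanSpace ℝ (Fin d))
      (show (0 : ℝ) < 2 by norm_num) ε
    rw [hB, this]
    simp
  have hpt : ∀ x ∈ W, B * ‖v x - w x‖ₑ ≤ ((∫⁻ y in Metric.ball x (2 * ε), ‖v x - v y‖ₑ) +
      ∫⁻ y in Metric.ball x (2 * ε), ‖w x - w y‖ₑ) + ENNReal.ofReal η := by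
    intro x hx
    -- Both `v x` and `w x` are compared with averages over a ball of the cover that contains `x`;
    -- this ball lies in `ball x (2 ε)`.
    obtain ⟨p, hpt, hxp⟩ := mem_iUnion₂.1 (ht hx)
    have hsub : Metric.ball p ε ⊆ Metric.ball x (2 * ε) :=
      Metric.ball_subset_ball' (by rw [dist_comm]; linarith [Metric.mem_ball.1 hxp])
    have hBp : volume (Metric.ball p ε) = B := Measure.addHaar_ball_center volume p ε
    have hint : ∀ u : EuclideanSpace ℝ (Fin d) → EuclideanSpace ℝ (Fin d), Integrable u →
        (volume.real (Metric.ball p ε)) • u x =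
          (∫ y in Metric.ball p ε, (u x - u y)) + ∫ y in Metric.ball p ε, u y := by
      intro u hu
      have hc : IntegrableOn (fun _ => u x) (Metric.ball p ε) volume :=
        integrableOn_const measure_ball_lt_top.ne
      rw [integral_sub hc hu.integrableOn, setIntegral_const]
      module
    have e : (volume.real (Metric.ball p ε)) • (v x - w x) =
        ((∫ y in Metric.ball p ε, (v x - v y)) - ∫ y in Metric.ball p ε, (w x - w y)) +
          ((∫ y in Metric.ball p ε, v y) - ∫ y in Metric.ball p ε, w y) := by
      rw [smul_sub, hint v hv.integrable, hint w hw.integrable]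
      module
    have e2 : B * ‖v x - w x‖ₑ = ‖(volume.real (Metric.ball p ε)) • (v x - w x)‖ₑ := by
      rw [enorm_smul, Real.enorm_eq_ofReal measureReal_nonneg, measureReal_def, hBp,
        ENNReal.ofReal_toReal hBt]
    rw [e2, e]
    refine (enorm_add_le _ _).trans (add_le_add ((enorm_sub_le).trans (add_le_add ?_ ?_)) ?_)
    · exact (enorm_integral_le_lintegral_enorm _).trans (lintegral_mono_set hsub)
    · exact (enorm_integral_le_lintegral_enorm _).trans (lintegral_mono_set hsub)
    · rw [← ofReal_norm]
      exact ENNReal.ofReal_le_ofReal (hη p hpt)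
  have hmeas : ∀ u : EuclideanSpace ℝ (Fin d) → EuclideanSpace ℝ (Fin d), Measurable u →
      Measurable fun x => ∫⁻ y in Metric.ball x (2 * ε), ‖u x - u y‖ₑ := by
    intro u hu
    have : (fun x => ∫⁻ y in Metric.ball x (2 * ε), ‖u x - u y‖ₑ) =
        fun x => ∫⁻ y, {q : EuclideanSpace ℝ (Fin d) × EuclideanSpace ℝ (Fin d) |
          dist q.2 q.1 < 2 * ε}.indicator (fun q => ‖u q.1 - u q.2‖ₑ) (x, y) := by
      ext x
      rw [← lintegral_indicator measurableSet_ball]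
      rfl
    rw [this]
    refine Measurable.lintegral_prod_right' (Measurable.indicator (by fun_prop) ?_)
    exact measurableSet_lt (by fun_prop) (by fun_prop)
  have hmv := hmeas v hvm
  have hmw := hmeas w hwm
  have hosc : ∀ u, IsBVBounded Ω C M u → ∫⁻ x in W, ∫⁻ y in Metric.ball x (2 * ε), ‖u x - u y‖ₑ ≤
      2 ^ d * B * (d * ENNReal.ofReal (2 ^ d * (2 * ε) * M)) := fun u hu => by
    rw [← hB2]
    exact hu.lintegral_lintegral_ball_le hW hWb (by positivity) hWΩ
  have key : B * ∫⁻ x in W, ‖v x - w x‖ₑ ≤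
      2 ^ d * B * (d * ENNReal.ofReal (2 ^ d * (2 * ε) * M)) +
      2 ^ d * B * (d * ENNReal.ofReal (2 ^ d * (2 * ε) * M)) + ENNReal.ofReal η * volume W := by
    rw [← lintegral_const_mul _ (by fun_prop)]
    refine (setLIntegral_mono' hW.measurableSet hpt).trans ?_
    rw [lintegral_add_right _ measurable_const, lintegral_add_left hmv, setLIntegral_const]
    gcongr
    · exact hosc v hv
    · exact hosc w hw
  calc ∫⁻ x in W, ‖v x - w x‖ₑ = B⁻¹ * (B * ∫⁻ x in W, ‖v x - w x‖ₑ) := by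
        rw [← mul_assoc, ENNReal.inv_mul_cancel hB0 hBt, one_mul]
    _ ≤ B⁻¹ * (2 ^ d * B * (d * ENNReal.ofReal (2 ^ d * (2 * ε) * M)) +
      2 ^ d * B * (d * ENNReal.ofReal (2 ^ d * (2 * ε) * M)) + ENNReal.ofReal η * volume W) := by
        gcongr
    _ = (B⁻¹ * B) * (2 * 2 ^ d * d * ENNReal.ofReal (2 ^ d * (2 * ε) * M)) +
          B⁻¹ * (volume W * ENNReal.ofReal η) := by ring
    _ = _ := by rw [ENNReal.inv_mul_cancel hB0 hBt, one_mul]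

end

/-! ### Compactness -/

section

/-- Lebesgue measure on `Ω`, weighted by the distance to the complement of `Ω`. Convergence in `L¹`
of this measure neglects the behaviour near the boundary. -/
noncomputable def boundaryWeighted {d : ℕ} (Ω : Set (EuclideanSpace ℝ (Fin d))) :
    Measure (EuclideanSpace ℝ (Fin d)) :=
  (volume.restrict Ω).withDensity fun x => ENNReal.ofReal (Metric.infDist x Ωᶜ)

variable {d : ℕ} {Ω : Set (EuclideanSpace ℝ (Fin d))} {C M : ℝ}
  {v : EuclideanSpace ℝ (Fin d) → EuclideanSpace ℝ (Fin d)}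

theorem measurable_ofReal_infDist (Ω : Set (EuclideanSpace ℝ (Fin d))) :
    Measurable fun x => ENNReal.ofReal (Metric.infDist x Ωᶜ) :=
  measurable_infDist.ennreal_ofReal

theorem lintegral_boundaryWeighted {g : EuclideanSpace ℝ (Fin d) → ℝ≥0∞} (hg : Measurable g) :
    ∫⁻ x, g x ∂(boundaryWeighted Ω) =
      ∫⁻ x in Ω, ENNReal.ofReal (Metric.infDist x Ωᶜ) * g x := by
  rw [boundaryWeighted, lintegral_withDensity_eq_lintegral_mul _ (measurable_ofReal_infDist Ω) hg]
  rfl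

theorem infDist_compl_pos (hΩ : IsOpen Ω) (hne : Ωᶜ.Nonempty) {x : EuclideanSpace ℝ (Fin d)}
    (hx : x ∈ Ω) : 0 < Metric.infDist x Ωᶜ :=
  (hΩ.isClosed_compl.notMem_iff_infDist_pos hne).1 (by simpa using hx)

theorem exists_infDist_compl_le (hΩb : Bornology.IsBounded Ω) (hne : Ωᶜ.Nonempty) :
    ∃ D : ℝ, 0 < D ∧ ∀ x ∈ Ω, Metric.infDist x Ωᶜ ≤ D := by
  obtain ⟨z, hz⟩ := hne
  obtain ⟨R, hR0, hR⟩ := hΩb.exists_pos_norm_le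
  refine ⟨R + ‖z‖, by positivity, fun x hx => (Metric.infDist_le_dist_of_mem hz).trans ?_⟩
  rw [dist_eq_norm]
  exact (norm_sub_le _ _).trans (by linarith [hR x hx])

theorem IsBVBounded.memLp_boundaryWeighted (hΩo : IsOpen Ω) (hΩb : Bornology.IsBounded Ω)
    (hne : Ωᶜ.Nonempty) (hv : IsBVBounded Ω C M v) : MemLp v 1 (boundaryWeighted Ω) := by
  obtain ⟨D, hD0, hD⟩ := exists_infDist_compl_le hΩb hne
  refine ⟨hv.measurable.aestronglyMeasurable, ?_⟩
  have hm := hv.measurable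
  rw [eLpNorm_one_eq_lintegral_enorm, lintegral_boundaryWeighted (by fun_prop)]
  calc _ ≤ ∫⁻ x in Ω, ENNReal.ofReal D * ‖v x‖ₑ :=
        setLIntegral_mono' hΩo.measurableSet fun x hx => by gcongr; exact hD x hx
    _ = ENNReal.ofReal D * ∫⁻ x in Ω, ‖v x‖ₑ := lintegral_const_mul _ (by fun_prop)
    _ ≤ ENNReal.ofReal D * ENNReal.ofReal C := by
        gcongr
        exact (setLIntegral_le_lintegral _ _).trans hv.lintegral_le
    _ < ⊤ := by finiteness

/-- Fields in a ball of `BV(Ω)^d` can be recovered, up to a small error in the weighted `L¹` norm,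
from finitely many integrals over balls. -/
theorem exists_finite_balls_lintegral_sub_lt (hΩo : IsOpen Ω) (hΩb : Bornology.IsBounded Ω)
    (hne : Ωᶜ.Nonempty) (hC : 0 ≤ C) (hM : 0 ≤ M) {ε₀ : ℝ} (hε₀ : 0 < ε₀) :
    ∃ ε > 0, ∃ η > 0, ∃ t : Set (EuclideanSpace ℝ (Fin d)), t.Finite ∧
      ∀ v w, IsBVBounded Ω C M v → IsBVBounded Ω C M w →
      (∀ p ∈ t, ‖(∫ x in Metric.ball p ε, v x) - ∫ x in Metric.ball p ε, w x‖ ≤ η) →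
      ∫⁻ x, ‖v x - w x‖ₑ ∂(boundaryWeighted Ω) < ENNReal.ofReal ε₀ := by
  obtain ⟨D, hD0, hD⟩ := exists_infDist_compl_le hΩb hne
  -- The width `δ` of the neglected boundary layer, the radius `ε` of the balls and the tolerance
  -- `η` each contribute less than `ε₀ / 3`; `δ` has to be chosen before `ε`, and `ε` before `η`.
  set δ := ε₀ / (6 * (C + 1)) with hδ
  have hδ0 : 0 < δ := by positivity
  set K : ℝ := 2 * 2 ^ d * d * (2 ^ d * 2 * M) with hK
  have hK0 : 0 ≤ K := by positivity
  set ε := min (δ / 2) (ε₀ / (3 * (D * K + 1))) with hε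
  have hε0 : 0 < ε := by positivity
  have hεδ : 2 * ε ≤ δ := by linarith [min_le_left (δ / 2) (ε₀ / (3 * (D * K + 1)))]
  set B := volume.real (Metric.ball (0 : EuclideanSpace ℝ (Fin d)) ε) with hB
  have hB0 : 0 < B := ENNReal.toReal_pos (Metric.measure_ball_pos volume 0 hε0).ne'
    measure_ball_lt_top.ne
  set L : ℝ := B⁻¹ * volume.real Ω with hL
  have hL0 : 0 ≤ L := by positivity
  set η := ε₀ / (3 * (D * L + 1)) with hη
  have hη0 : 0 < η := by positivity
  have htb : TotallyBounded Ω := hΩb.isCompact_closure.totallyBounded.subset subset_closure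
  obtain ⟨t, -, htf, ht⟩ := Metric.finite_approx_of_totallyBounded htb ε hε0
  refine ⟨ε, hε0, η, hη0, t, htf, fun v w hv hw hvw => ?_⟩
  have hvm := hv.measurable
  have hwm := hw.measurable
  set W := {x | δ < Metric.infDist x Ωᶜ} with hW
  have hWo : IsOpen W := isOpen_lt continuous_const (Metric.continuous_infDist_pt _)
  have hball : ∀ x ∈ W, Metric.ball x (2 * ε) ⊆ Ω := by
    intro x hx y hy
    by_contra hyΩ
    have h1 := Metric.infDist_le_dist_of_mem (x := x) (show y ∈ Ωᶜ from hyΩ)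
    rw [Metric.mem_ball, dist_comm] at hy
    have h2 : δ < Metric.infDist x Ωᶜ := hx
    linarith
  have hWΩ : W ⊆ Ω := fun x hx => hball x hx (Metric.mem_ball_self (by positivity))
  have h1 := hv.lintegral_sub_le_of_integral_ball hw hWo (hΩb.subset hWΩ) hε0 hball
    (hWΩ.trans ht) hvw
  have h2 : ∫⁻ x in W, ‖v x - w x‖ₑ ≤ ENNReal.ofReal (K * ε + L * η) := by
    refine h1.trans ?_
    have e1 : 2 * 2 ^ d * d * ENNReal.ofReal (2 ^ d * (2 * ε) * M) = ENNReal.ofReal (K * ε) := by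
      have : K * ε = (2 * 2 ^ d * d) * (2 ^ d * (2 * ε) * M) := by rw [hK]; ring
      rw [this, ENNReal.ofReal_mul (p := 2 * 2 ^ d * d) (by positivity),
        ENNReal.ofReal_mul (p := 2 * 2 ^ d) (by positivity),
        ENNReal.ofReal_mul (p := 2) (by positivity), ENNReal.ofReal_pow (by positivity)]
      simp
    have hΩfin : volume Ω ≠ ⊤ := hΩb.measure_lt_top.ne
    have e2 : (volume (Metric.ball (0 : EuclideanSpace ℝ (Fin d)) ε))⁻¹ *
        (volume W * ENNReal.ofReal η) ≤ ENNReal.ofReal (L * η) := by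
      rw [hL, ENNReal.ofReal_mul (by positivity), ENNReal.ofReal_mul (by positivity),
        ENNReal.ofReal_inv_of_pos hB0, hB, ofReal_measureReal measure_ball_lt_top.ne,
        ofReal_measureReal hΩfin, mul_assoc]
      gcongr
    rw [e1, ENNReal.ofReal_add (by positivity) (by positivity)]
    gcongr
  have h3 : ∫⁻ x, ‖v x - w x‖ₑ ∂(boundaryWeighted Ω) ≤
      ENNReal.ofReal D * (∫⁻ x in W, ‖v x - w x‖ₑ) +
        ENNReal.ofReal δ * ((∫⁻ x, ‖v x‖ₑ) + ∫⁻ x, ‖w x‖ₑ) := by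
    rw [lintegral_boundaryWeighted (by fun_prop)]
    calc ∫⁻ x in Ω, ENNReal.ofReal (Metric.infDist x Ωᶜ) * ‖v x - w x‖ₑ
        ≤ ∫⁻ x in Ω, (W.indicator (fun x => ENNReal.ofReal D * ‖v x - w x‖ₑ) x +
            ENNReal.ofReal δ * (‖v x‖ₑ + ‖w x‖ₑ)) := by
          refine setLIntegral_mono' hΩo.measurableSet fun x hx => ?_
          by_cases hxW : x ∈ W
          · rw [indicator_of_mem hxW]
            refine le_add_right ?_
            gcongr
            exact hD x hx
          · rw [indicator_of_notMem hxW, zero_add]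
            have hxδ : Metric.infDist x Ωᶜ ≤ δ := not_lt.1 hxW
            gcongr
            exact enorm_sub_le
      _ ≤ ∫⁻ x, (W.indicator (fun x => ENNReal.ofReal D * ‖v x - w x‖ₑ) x +
            ENNReal.ofReal δ * (‖v x‖ₑ + ‖w x‖ₑ)) := setLIntegral_le_lintegral _ _
      _ = _ := by
          rw [lintegral_add_left (Measurable.indicator (by fun_prop) hWo.measurableSet),
            lintegral_indicator hWo.measurableSet, lintegral_const_mul _ (by fun_prop),
            lintegral_const_mul _ (by fun_prop), lintegral_add_left (by fun_prop)]
  calc ∫⁻ x, ‖v x - w x‖ₑ ∂(boundaryWeighted Ω)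
      ≤ ENNReal.ofReal D * ENNReal.ofReal (K * ε + L * η) +
        ENNReal.ofReal δ * (ENNReal.ofReal C + ENNReal.ofReal C) := by
        refine h3.trans ?_
        gcongr
        · exact hv.lintegral_le
        · exact hw.lintegral_le
    _ = ENNReal.ofReal (D * (K * ε + L * η) + δ * (C + C)) := by
        rw [ENNReal.ofReal_add (p := D * (K * ε + L * η)) (by positivity) (by positivity),
          ENNReal.ofReal_mul hD0.le, ENNReal.ofReal_mul hδ0.le, ENNReal.ofReal_add hC hC]
    _ < ENNReal.ofReal ε₀ := by
        refine (ENNReal.ofReal_lt_ofReal_iff hε₀).2 ?_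
        have a1 : D * K * ε < ε₀ / 3 := by
          calc D * K * ε ≤ D * K * (ε₀ / (3 * (D * K + 1))) := by
                gcongr
                exact min_le_right _ _
            _ < ε₀ / 3 := by
                rw [← mul_div_assoc, div_lt_div_iff₀ (by positivity) (by norm_num)]
                nlinarith [mul_nonneg hD0.le hK0]
        have a2 : D * L * η < ε₀ / 3 := by
          rw [hη, ← mul_div_assoc, div_lt_div_iff₀ (by positivity) (by norm_num)]
          nlinarith [mul_nonneg hD0.le hL0]
        have a3 : δ * (C + C) < ε₀ / 3 := by
          rw [hδ, div_mul_eq_mul_div, div_lt_div_iff₀ (by positivity) (by norm_num)]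
          nlinarith
        linarith

theorem totallyBounded_setOf_isBVBounded (hΩo : IsOpen Ω) (hΩb : Bornology.IsBounded Ω)
    (hne : Ωᶜ.Nonempty) (hC : 0 ≤ C) (hM : 0 ≤ M) :
    TotallyBounded {F : Lp (EuclideanSpace ℝ (Fin d)) 1 (boundaryWeighted Ω) |
      ∃ v, ∃ hv : MemLp v 1 (boundaryWeighted Ω), IsBVBounded Ω C M v ∧ F = hv.toLp v} := by
  refine Metric.totallyBounded_of_finite_discretization fun ε₀ hε₀ => ?_
  obtain ⟨ε, hε, η, hη, t, htf, H⟩ :=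
    exists_finite_balls_lintegral_sub_lt hΩo hΩb hne hC hM hε₀
  have := htf.fintype
  -- The integrals over the balls form a point of a ball in a finite-dimensional space; a point
  -- of a finite net `N` of that ball serves as the discrete datum.
  have htb : TotallyBounded (Metric.closedBall (0 : t → EuclideanSpace ℝ (Fin d)) C) :=
    (isCompact_closedBall _ _).totallyBounded
  obtain ⟨N, -, hNf, hN⟩ := Metric.finite_approx_of_totallyBounded htb (η / 2) (by positivity)
  have := hNf.fintype
  have hex : ∀ F : {F : Lp (EuclideanSpace ℝ (Fin d)) 1 (boundaryWeighted Ω) |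
      ∃ v, ∃ hv : MemLp v 1 (boundaryWeighted Ω), IsBVBounded Ω C M v ∧ F = hv.toLp v},
      ∃ (a : N) (v : EuclideanSpace ℝ (Fin d) → EuclideanSpace ℝ (Fin d))
        (hv : MemLp v 1 (boundaryWeighted Ω)), IsBVBounded Ω C M v ∧ F.1 = hv.toLp v ∧
        dist (fun p : t => ∫ x in Metric.ball p.1 ε, v x) a.1 < η / 2 := by
    rintro ⟨F, v, hv, hvb, rfl⟩
    have hmem : (fun p : t => ∫ x in Metric.ball p.1 ε, v x) ∈
        Metric.closedBall (0 : t → EuclideanSpace ℝ (Fin d)) C := by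
      rw [mem_closedBall_zero_iff, pi_norm_le_iff_of_nonneg hC]
      intro p
      have h1 : ‖∫ x in Metric.ball p.1 ε, v x‖ₑ ≤ ENNReal.ofReal C :=
        (enorm_integral_le_lintegral_enorm _).trans
          ((setLIntegral_le_lintegral _ _).trans hvb.lintegral_le)
      rwa [← ofReal_norm, ENNReal.ofReal_le_ofReal_iff hC] at h1
    obtain ⟨a, ha, had⟩ := mem_iUnion₂.1 (hN hmem)
    exact ⟨⟨a, ha⟩, v, hv, hvb, rfl, had⟩
  choose a v hv hvb hFv hav using hex
  refine ⟨N, inferInstance, a, fun F F' h => ?_⟩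
  have hd : ∀ p ∈ t, ‖(∫ x in Metric.ball p ε, v F x) - ∫ x in Metric.ball p ε, v F' x‖ ≤ η := by
    intro p hp
    rw [← dist_eq_norm]
    have h1 := hav F
    have h2 := hav F'
    rw [← h] at h2
    have h3 := (dist_triangle_right (fun p : t => ∫ x in Metric.ball p.1 ε, v F x)
      (fun p : t => ∫ x in Metric.ball p.1 ε, v F' x) (a F).1)
    have h4 := dist_le_pi_dist (fun p : t => ∫ x in Metric.ball p.1 ε, v F x)
      (fun p : t => ∫ x in Metric.ball p.1 ε, v F' x) ⟨p, hp⟩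
    simp only at h4
    linarith
  have h5 := H _ _ (hvb F) (hvb F') hd
  rw [hFv F, hFv F', ← edist_lt_ofReal, Lp.edist_toLp_toLp, eLpNorm_one_eq_lintegral_enorm]
  exact h5

/-- **Rellich compactness**, in local form: a sequence in a ball of `BV(Ω)^d` has a subsequence
that converges almost everywhere and weakly against test functions. -/
theorem exists_subseq_tendsto_of_isBVBounded (hΩo : IsOpen Ω) (hΩb : Bornology.IsBounded Ω)
    (hne : Ωᶜ.Nonempty) (hC : 0 ≤ C) (hM : 0 ≤ M)
    {v : ℕ → EuclideanSpace ℝ (Fin d) → EuclideanSpace ℝ (Fin d)}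
    (hv : ∀ n, IsBVBounded Ω C M (v n)) :
    ∃ (φ : ℕ → ℕ) (g : EuclideanSpace ℝ (Fin d) → EuclideanSpace ℝ (Fin d)), StrictMono φ ∧
      Measurable g ∧ ∫⁻ x in Ω, ‖g x‖ₑ ≤ ENNReal.ofReal C ∧
      (∀ᵐ x ∂(volume.restrict Ω), Tendsto (fun n => v (φ n) x) atTop (𝓝 (g x))) ∧
      ∀ (i : Fin d) (ψ : EuclideanSpace ℝ (Fin d) → ℝ), IsTestFunction Ω ψ →
        Tendsto (fun n => ∫ x in Ω, v (φ n) x i * ψ x) atTop (𝓝 (∫ x in Ω, g x i * ψ x)) := by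
  have hmem := fun n => (hv n).memLp_boundaryWeighted hΩo hΩb hne
  have hcomp := (totallyBounded_setOf_isBVBounded hΩo hΩb hne hC hM).closure.isCompact_of_isClosed
    isClosed_closure
  obtain ⟨G₀, -, φ₁, hφ₁, hG⟩ := hcomp.tendsto_subseq (x := fun n => (hmem n).toLp (v n))
    fun n => subset_closure ⟨v n, hmem n, hv n, rfl⟩
  obtain ⟨G, hgm, hGm, rfl⟩ : ∃ G : EuclideanSpace ℝ (Fin d) → EuclideanSpace ℝ (Fin d),
      Measurable G ∧ ∃ hGm : MemLp G 1 (boundaryWeighted Ω), hGm.toLp G = G₀ :=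
    ⟨G₀, (Lp.stronglyMeasurable G₀).measurable, Lp.memLp G₀, Lp.toLp_coeFn _ _⟩
  have hconv : Tendsto (fun n => eLpNorm (v (φ₁ n) - G) 1 (boundaryWeighted Ω)) atTop (𝓝 0) := by
    rw [← Lp.tendsto_Lp_iff_tendsto_eLpNorm'' (fun n => v (φ₁ n)) (fun n => hmem (φ₁ n)) G hGm]
    exact hG
  obtain ⟨φ₂, hφ₂, hae⟩ := (tendstoInMeasure_of_tendsto_eLpNorm one_ne_zero
    (fun n => (hmem (φ₁ n)).1) hGm.1 hconv).exists_seq_tendsto_ae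
  have hae' : ∀ᵐ x ∂(volume.restrict Ω),
      Tendsto (fun n => v (φ₁ (φ₂ n)) x) atTop (𝓝 (G x)) := by
    rw [boundaryWeighted, ae_withDensity_iff (measurable_ofReal_infDist Ω)] at hae
    filter_upwards [hae, ae_restrict_mem hΩo.measurableSet] with x hx hxΩ
    exact hx (ENNReal.ofReal_pos.2 (infDist_compl_pos hΩo hne hxΩ)).ne'
  have hGC : ∫⁻ x in Ω, ‖G x‖ₑ ≤ ENNReal.ofReal C := by
    calc ∫⁻ x in Ω, ‖G x‖ₑ ≤ ∫⁻ x in Ω, liminf (fun n => ‖v (φ₁ (φ₂ n)) x‖ₑ) atTop := by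
          refine lintegral_mono_ae ?_
          filter_upwards [hae'] with x hx
          exact ((continuous_enorm.tendsto _).comp hx).liminf_eq.ge
      _ ≤ liminf (fun n => ∫⁻ x in Ω, ‖v (φ₁ (φ₂ n)) x‖ₑ) atTop :=
          lintegral_liminf_le fun n => (hv _).measurable.enorm
      _ ≤ ENNReal.ofReal C := by
          refine liminf_le_of_le (by isBoundedDefault) fun b hb => ?_
          obtain ⟨n, hn⟩ := hb.exists
          exact hn.trans ((setLIntegral_le_lintegral _ _).trans (hv _).lintegral_le)
  refine ⟨φ₁ ∘ φ₂, G, hφ₁.comp hφ₂, hgm, hGC, hae', fun i ψ hψ => ?_⟩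
  -- On its support `ψ` is dominated by a multiple of the weight.
  obtain ⟨c, hc0, hc⟩ := hψ.2.1.isCompact.exists_forall_le'
    (Metric.continuous_infDist_pt Ωᶜ).continuousOn
    (fun x hx => infDist_compl_pos hΩo hne (hψ.2.2 hx))
  obtain ⟨A, hA⟩ := hψ.exists_bound
  have hA0 : 0 ≤ A := (abs_nonneg _).trans (hA 0)
  have hGi : Integrable (fun x => G x i) (volume.restrict Ω) :=
    (EuclideanSpace.proj (𝕜 := ℝ) i).integrable_comp
      ⟨hgm.aestronglyMeasurable, hGC.trans_lt ENNReal.ofReal_lt_top⟩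
  have hψm : ∀ f : EuclideanSpace ℝ (Fin d) → ℝ, Integrable f (volume.restrict Ω) →
      Integrable (fun x => f x * ψ x) (volume.restrict Ω) := fun f hf =>
    hf.mul_bdd (c := A) hψ.1.continuous.aestronglyMeasurable (ae_of_all _ hA)
  have hvi : ∀ n, Integrable (fun x => v n x i) (volume.restrict Ω) := fun n =>
    ((EuclideanSpace.proj (𝕜 := ℝ) i).integrable_comp (hv n).integrable).integrableOn
  rw [tendsto_iff_edist_tendsto_0]
  have hbd : ∀ n, edist (∫ x in Ω, v (φ₁ (φ₂ n)) x i * ψ x) (∫ x in Ω, G x i * ψ x) ≤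
      ENNReal.ofReal (A / c) * eLpNorm (v (φ₁ (φ₂ n)) - G) 1 (boundaryWeighted Ω) := by
    intro n
    have hvm := (hv (φ₁ (φ₂ n))).measurable
    have hmul : Measurable fun x =>
        ENNReal.ofReal (Metric.infDist x Ωᶜ) * ‖(v (φ₁ (φ₂ n)) - G) x‖ₑ :=
      (measurable_ofReal_infDist Ω).mul (hvm.sub hgm).enorm
    rw [edist_eq_enorm_sub, ← integral_sub (hψm _ (hvi _)) (hψm _ hGi),
      eLpNorm_one_eq_lintegral_enorm, lintegral_boundaryWeighted (hvm.sub hgm).enorm,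
      ← lintegral_const_mul _ hmul]
    refine (enorm_integral_le_lintegral_enorm _).trans
      (setLIntegral_mono' hΩo.measurableSet fun x hx => ?_)
    rw [← sub_mul, enorm_mul, ← mul_assoc, mul_comm]
    have hω := infDist_compl_pos hΩo hne hx
    gcongr
    · rw [← ENNReal.ofReal_mul (by positivity), Real.enorm_eq_ofReal_abs]
      refine ENNReal.ofReal_le_ofReal ?_
      by_cases hxs : x ∈ tsupport ψ
      · calc |ψ x| ≤ A := hA x
          _ = A / c * c := by field_simp
          _ ≤ _ := by gcongr; exact hc x hxs
      · rw [image_eq_zero_of_notMem_tsupport hxs, abs_zero]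
        positivity
    · rw [← ofReal_norm, ← ofReal_norm]
      exact ENNReal.ofReal_le_ofReal (PiLp.norm_apply_le (v (φ₁ (φ₂ n)) x - G x) i)
  refine tendsto_of_tendsto_of_tendsto_of_le_of_le tendsto_const_nhds ?_ (fun _ => zero_le)
    hbd
  have := ENNReal.Tendsto.const_mul (a := ENNReal.ofReal (A / c))
    (hconv.comp hφ₂.tendsto_atTop) (Or.inr ENNReal.ofReal_ne_top)
  simpa using this

end

/-! ### Coercivity -/

section

variable {d : ℕ} {Ω : Set (EuclideanSpace ℝ (Fin d))}
  {G : EuclideanSpace ℝ (Fin d) → EuclideanSpace ℝ (Fin d)}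

theorem exists_ae_enorm_inner_le (hG : ∀ i : Fin d, MemLp (fun x => G x i) ⊤ (volume.restrict Ω)) :
    ∃ L : ℝ≥0∞, L ≠ ⊤ ∧ ∀ᵐ x ∂(volume.restrict Ω), ∀ y, ‖(inner ℝ (G x) y : ℝ)‖ₑ ≤ L * ‖y‖ₑ := by
  refine ⟨∑ i, eLpNorm (fun x => G x i) ⊤ (volume.restrict Ω),
    ENNReal.sum_ne_top.2 fun i _ => (hG i).2.ne, ?_⟩
  have h : ∀ᵐ x ∂(volume.restrict Ω), ∀ i, ‖G x i‖ₑ ≤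
      eLpNorm (fun x => G x i) ⊤ (volume.restrict Ω) := by
    rw [ae_all_iff]
    intro i
    simpa only [eLpNorm_exponent_top] using ae_le_eLpNormEssSup
  filter_upwards [h] with x hx y
  rw [PiLp.inner_apply, Finset.sum_mul]
  refine (enorm_sum_le _ _).trans (Finset.sum_le_sum fun i _ => ?_)
  have h1 : (inner ℝ (G x i) (y i) : ℝ) = G x i * y i := by simp [mul_comm]
  rw [h1, enorm_mul]
  gcongr
  · exact hx i
  · rw [← ofReal_norm, ← ofReal_norm]
    exact ENNReal.ofReal_le_ofReal (PiLp.norm_apply_le y i)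

/-- Linear independence of the components of `G` makes `c ↦ ∫_Ω |G · c|` a norm on the constant
fields, hence equivalent to the Euclidean one. -/
theorem exists_enorm_le_lintegral_inner (hΩb : Bornology.IsBounded Ω)
    (hGm : AEStronglyMeasurable G (volume.restrict Ω))
    (hG : ∀ i : Fin d, MemLp (fun x => G x i) ⊤ (volume.restrict Ω))
    (hli : LinearIndependent ℝ
      (fun i : Fin d => ((hG i).toLp (fun x => G x i) : Lp ℝ ⊤ (volume.restrict Ω)))) :
    ∃ K : ℝ≥0∞, K ≠ ⊤ ∧ ∀ c : EuclideanSpace ℝ (Fin d),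
      ‖c‖ₑ ≤ K * ∫⁻ x in Ω, ‖(inner ℝ (G x) c : ℝ)‖ₑ := by
  obtain ⟨L, hL, hGL⟩ := exists_ae_enorm_inner_le hG
  have hΩfin : volume Ω ≠ ⊤ := hΩb.measure_lt_top.ne
  have hm : ∀ c : EuclideanSpace ℝ (Fin d),
      MemLp (fun x => (inner ℝ (G x) c : ℝ)) 1 (volume.restrict Ω) := by
    intro c
    refine ⟨hGm.inner aestronglyMeasurable_const, ?_⟩
    rw [eLpNorm_one_eq_lintegral_enorm]
    calc _ ≤ ∫⁻ _x in Ω, L * ‖c‖ₑ := lintegral_mono_ae (hGL.mono fun x hx => hx c)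
      _ = L * ‖c‖ₑ * volume Ω := setLIntegral_const _ _
      _ < ⊤ := by finiteness
  let T : EuclideanSpace ℝ (Fin d) →ₗ[ℝ] Lp ℝ 1 (volume.restrict Ω) :=
    { toFun := fun c => (hm c).toLp _
      map_add' := fun c c' => by
        rw [← MemLp.toLp_add, MemLp.toLp_eq_toLp_iff]
        exact ae_of_all _ fun x => inner_add_right _ _ _
      map_smul' := fun a c => by
        rw [RingHom.id_apply, ← MemLp.toLp_const_smul, MemLp.toLp_eq_toLp_iff]
        exact ae_of_all _ fun x => inner_smul_right _ _ _ }
  have hker : T.ker = ⊥ := by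
    rw [LinearMap.ker_eq_bot']
    intro c hc
    have hc' : (hm c).toLp _ = 0 := hc
    have h0 : ∀ᵐ x ∂(volume.restrict Ω), (inner ℝ (G x) c : ℝ) = 0 := by
      filter_upwards [(hm c).coeFn_toLp, Lp.coeFn_zero ℝ 1 (volume.restrict Ω)] with x h1 h2
      rw [← h1, hc', h2, Pi.zero_apply]
    have hsum : ∑ i, c i • ((hG i).toLp (fun x => G x i) : Lp ℝ ⊤ (volume.restrict Ω)) = 0 := by
      refine Lp.ext ?_
      have hi : ∀ᵐ x ∂(volume.restrict Ω), ∀ i,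
          (c i • ((hG i).toLp (fun x => G x i) : Lp ℝ ⊤ (volume.restrict Ω))) x = c i * G x i := by
        rw [ae_all_iff]
        intro i
        filter_upwards [Lp.coeFn_smul (c i) ((hG i).toLp (fun x => G x i)), (hG i).coeFn_toLp]
          with x h1 h2
        rw [h1, Pi.smul_apply, h2, smul_eq_mul]
      filter_upwards [Lp.coeFn_finsetSum Finset.univ
        fun i => c i • ((hG i).toLp (fun x => G x i) : Lp ℝ ⊤ (volume.restrict Ω)), hi, h0,
        Lp.coeFn_zero ℝ ⊤ (volume.restrict Ω)] with x h1 h2 h3 h4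
      rw [h1, h4, Finset.sum_apply, Finset.sum_congr rfl fun i _ => h2 i]
      simpa [PiLp.inner_apply] using h3
    ext i
    exact Fintype.linearIndependent_iff.1 hli (fun i => c i) hsum i
  obtain ⟨K, -, hK⟩ := T.exists_antilipschitzWith hker
  refine ⟨K, ENNReal.coe_ne_top, fun c => ?_⟩
  have h1 := hK c 0
  rw [map_zero, edist_zero_right, edist_zero_right] at h1
  refine h1.trans_eq ?_
  change (K : ℝ≥0∞) * ‖(hm c).toLp _‖ₑ = _
  rw [Lp.enorm_toLp, eLpNorm_one_eq_lintegral_enorm]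

/-- Coercivity: a bound on the variation and on the `L¹` norm of the data term bounds the field in
`L¹`. By the Poincaré inequality the field is close to a constant, whose size the data term
controls. -/
theorem exists_lintegral_le_of_dataTerm_le (hΩo : IsOpen Ω) (hΩc : IsConnected Ω)
    (hΩb : Bornology.IsBounded Ω) (hcone : ConeCondition Ω)
    {ut : EuclideanSpace ℝ (Fin d) → ℝ} (hut : Integrable ut (volume.restrict Ω))
    (hGm : AEStronglyMeasurable G (volume.restrict Ω))
    (hG : ∀ i : Fin d, MemLp (fun x => G x i) ⊤ (volume.restrict Ω))
    (hli : LinearIndependent ℝ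
      (fun i : Fin d => ((hG i).toLp (fun x => G x i) : Lp ℝ ⊤ (volume.restrict Ω))))
    {A : ℝ≥0∞} (hA : A ≠ ⊤) (M : ℝ) :
    ∃ C : ℝ≥0∞, C ≠ ⊤ ∧ ∀ v : EuclideanSpace ℝ (Fin d) → EuclideanSpace ℝ (Fin d), Measurable v →
      Integrable v → (∀ i, HasVariationBound Ω (fun x => v x i) M) →
      ∫⁻ x in Ω, ‖ut x + inner ℝ (G x) (v x)‖ₑ ≤ A → ∫⁻ x in Ω, ‖v x‖ₑ ≤ C := by
  obtain ⟨P, hP, hosc⟩ := oscillationControlled_self hΩo hΩc hΩb hcone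
  obtain ⟨L, hL, hGL⟩ := exists_ae_enorm_inner_le hG
  obtain ⟨K, hK, hGK⟩ := exists_enorm_le_lintegral_inner hΩb hGm hG hli
  have hΩfin : volume Ω ≠ ⊤ := hΩb.measure_lt_top.ne
  have hΩ0 : volume Ω ≠ 0 := (hΩo.measure_pos volume hΩc.nonempty).ne'
  set U := ∫⁻ x in Ω, ‖ut x‖ₑ with hU
  have hUfin : U ≠ ⊤ := hut.2.ne
  set Q := (d * (P * ENNReal.ofReal M)) / volume Ω with hQ
  have hQfin : Q ≠ ⊤ := ENNReal.div_ne_top (by finiteness) hΩ0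
  refine ⟨Q + volume Ω * (K * (A + U + L * Q)), by finiteness, fun v hvm hvi hvM hvA => ?_⟩
  have hdouble : ∫⁻ y in Ω, ∫⁻ x in Ω, ‖v x - v y‖ₑ ≤ d * (P * ENNReal.ofReal M) := by
    rw [lintegral_lintegral_swap (Measurable.aemeasurable (by fun_prop))]
    calc ∫⁻ x in Ω, ∫⁻ y in Ω, ‖v x - v y‖ₑ ≤ ∫⁻ x in Ω, ∫⁻ y in Ω, ∑ i, ‖v x i - v y i‖ₑ :=
          lintegral_mono fun x => lintegral_mono fun y => enorm_le_sum_enorm_apply _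
      _ = ∑ i, ∫⁻ x in Ω, ∫⁻ y in Ω, ‖v x i - v y i‖ₑ := by
          rw [← lintegral_finsetSum _ fun i _ => by fun_prop]
          refine lintegral_congr fun x => ?_
          rw [lintegral_finsetSum _ fun i _ => by fun_prop]
      _ ≤ ∑ _i : Fin d, P * ENNReal.ofReal M := Finset.sum_le_sum fun i _ =>
          hosc _ M (by fun_prop) ((EuclideanSpace.proj (𝕜 := ℝ) i).integrable_comp hvi) (hvM i)
      _ = _ := by simp
  -- The constant compared with `v` is its value `v y` at a point `y` where the oscillation does not
  -- exceed its mean.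
  obtain ⟨y, -, hy⟩ := exists_le_setLAverage hΩ0 hΩfin
    (f := fun y => ∫⁻ x in Ω, ‖v x - v y‖ₑ) (Measurable.aemeasurable (by fun_prop))
  have hyQ : ∫⁻ x in Ω, ‖v x - v y‖ₑ ≤ Q := by
    refine hy.trans ?_
    rw [setLAverage_eq]
    exact ENNReal.div_le_div_right hdouble _
  have hcst : ∫⁻ x in Ω, ‖(inner ℝ (G x) (v y) : ℝ)‖ₑ ≤ A + U + L * Q := by
    have hpt : ∀ᵐ x ∂(volume.restrict Ω), ‖(inner ℝ (G x) (v y) : ℝ)‖ₑ ≤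
        ‖ut x + inner ℝ (G x) (v x)‖ₑ + ‖ut x‖ₑ + L * ‖v x - v y‖ₑ := by
      filter_upwards [hGL] with x hx
      have e : (inner ℝ (G x) (v y) : ℝ) =
          (ut x + inner ℝ (G x) (v x)) - ut x - inner ℝ (G x) (v x - v y) := by
        rw [inner_sub_right]; ring
      rw [e]
      exact enorm_sub_le.trans (add_le_add enorm_sub_le (hx _))
    refine (lintegral_mono_ae hpt).trans ?_
    rw [lintegral_add_right _ (by fun_prop), lintegral_add_right' _ hut.1.enorm,
      lintegral_const_mul _ (by fun_prop)]
    gcongr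
  calc ∫⁻ x in Ω, ‖v x‖ₑ ≤ ∫⁻ x in Ω, (‖v x - v y‖ₑ + ‖v y‖ₑ) := by
        refine lintegral_mono fun x => ?_
        simpa using enorm_add_le (v x - v y) (v y)
    _ = (∫⁻ x in Ω, ‖v x - v y‖ₑ) + volume Ω * ‖v y‖ₑ := by
        rw [lintegral_add_right _ measurable_const, setLIntegral_const, mul_comm]
    _ ≤ _ := by
        gcongr
        exact (hGK _).trans (by gcongr)

end

/-! ### Lower semicontinuity -/

section

variable {d : ℕ} {Ω : Set (EuclideanSpace ℝ (Fin d))}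
  {G : EuclideanSpace ℝ (Fin d) → EuclideanSpace ℝ (Fin d)}

theorem TVVariant.DualBall.of_isotropic {A : Fin d → Fin d → ℝ}
    (h : TVVariant.isotropic.DualBall A) (s : TVVariant) : s.DualBall A := by
  have h' : ∑ i, ∑ j, A i j ^ 2 ≤ 1 := h
  have hrow : ∀ i, ∑ j, A i j ^ 2 ≤ 1 := fun i =>
    (Finset.single_le_sum (f := fun i => ∑ j, A i j ^ 2)
      (fun i _ => Finset.sum_nonneg fun j _ => sq_nonneg _) (Finset.mem_univ i)).trans h'
  cases s with
  | isotropic => exact h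
  | componentwise => exact hrow
  | anisotropic =>
    intro i j
    have := (Finset.single_le_sum (f := fun j => A i j ^ 2)
      (fun j _ => sq_nonneg _) (Finset.mem_univ j)).trans (hrow i)
    exact (sq_le_one_iff_abs_le_one _).1 this

theorem totalVariation_isotropic_le (s : TVVariant)
    (v : EuclideanSpace ℝ (Fin d) → EuclideanSpace ℝ (Fin d)) :
    totalVariation .isotropic Ω v ≤ totalVariation s Ω v :=
  iSup₂_le fun φ hφ => le_iSup₂_of_le φ ⟨hφ.1, fun x => (hφ.2 x).of_isotropic s⟩ le_rfl

theorem hasVariationBound_apply_of_totalVariation_le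
    {v : EuclideanSpace ℝ (Fin d) → EuclideanSpace ℝ (Fin d)} {M : ℝ} (hM : 0 ≤ M)
    (h : totalVariation .isotropic Ω v ≤ ENNReal.ofReal M) (i : Fin d) :
    HasVariationBound Ω (fun x => v x i) M := by
  classical
  intro φ hφ hφ1
  have hΦ : IsDualField .isotropic Ω (fun k j => if k = i then φ j else 0) := by
    refine ⟨fun k j => ?_, fun x => ?_⟩
    · dsimp only
      split_ifs with hk
      · exact hφ j
      · exact ⟨contDiff_const, HasCompactSupport.zero, by simp [tsupport]⟩
    · change ∑ k, ∑ j, (if k = i then φ j else 0) x ^ 2 ≤ 1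
      rw [Finset.sum_eq_single i]
      · simpa using hφ1 x
      · intro k _ hk
        simp [hk]
      · simp
  have h1 := (le_iSup₂ (f := fun (φ : Fin d → Fin d → EuclideanSpace ℝ (Fin d) → ℝ)
    (_ : IsDualField .isotropic Ω φ) =>
    ENNReal.ofReal (∫ x in Ω, ∑ i, v x i * ∑ j, partialDeriv j (φ i j) x)) _ hΦ).trans h
  rw [ENNReal.ofReal_le_ofReal_iff hM] at h1
  refine le_of_eq_of_le ?_ h1
  congr 1 with x
  symm
  refine (Finset.sum_eq_single i ?_ ?_).trans ?_
  · intro k _ hk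
    simp [hk, partialDeriv]
  · simp
  · simp

theorem lpTVEnergy_congr {p : ℕ} {s : TVVariant} {α : ℝ} {ut : EuclideanSpace ℝ (Fin d) → ℝ}
    {v w : EuclideanSpace ℝ (Fin d) → EuclideanSpace ℝ (Fin d)}
    (h : v =ᵐ[volume.restrict Ω] w) :
    lpTVEnergy p s α Ω ut G v = lpTVEnergy p s α Ω ut G w := by
  have h1 : ∫⁻ x in Ω, ‖ut x + inner ℝ (G x) (v x)‖ₑ ^ p =
      ∫⁻ x in Ω, ‖ut x + inner ℝ (G x) (w x)‖ₑ ^ p :=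
    lintegral_congr_ae (h.mono fun x hx => by simp only [hx])
  have h2 : totalVariation s Ω v = totalVariation s Ω w := by
    unfold totalVariation
    refine iSup_congr fun φ => iSup_congr fun _ => ?_
    congr 1
    exact integral_congr_ae (h.mono fun x hx => by simp only [hx])
  rw [lpTVEnergy, lpTVEnergy, h1, h2]

theorem MemBV.exists_measurable_integrable (hΩ : IsOpen Ω)
    {w : EuclideanSpace ℝ (Fin d) → EuclideanSpace ℝ (Fin d)} (hw : MemBV Ω w) :
    ∃ v, Measurable v ∧ Integrable v ∧ v =ᵐ[volume.restrict Ω] w ∧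
      ∫⁻ x, ‖v x‖ₑ = ∫⁻ x in Ω, ‖v x‖ₑ := by
  have hm := hw.1.1.stronglyMeasurable_mk
  have hae : Ω.indicator (hw.1.1.mk w) =ᵐ[volume.restrict Ω] w := by
    filter_upwards [hw.1.1.ae_eq_mk, ae_restrict_mem hΩ.measurableSet] with x hx hxΩ
    rw [indicator_of_mem hxΩ, hx]
  refine ⟨Ω.indicator (hw.1.1.mk w), hm.measurable.indicator hΩ.measurableSet, ?_, hae, ?_⟩
  · rw [integrable_indicator_iff hΩ.measurableSet]
    exact (memLp_one_iff_integrable.1 hw.1).congr hw.1.1.ae_eq_mk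
  · rw [← lintegral_indicator hΩ.measurableSet]
    refine lintegral_congr fun x => ?_
    by_cases hx : x ∈ Ω <;> simp [hx]

theorem liminf_add_liminf_le_ennreal (a b : ℕ → ℝ≥0∞) :
    liminf a atTop + liminf b atTop ≤ liminf (fun n => a n + b n) atTop := by
  rw [liminf_eq_iSup_iInf_of_nat, liminf_eq_iSup_iInf_of_nat, liminf_eq_iSup_iInf_of_nat,
    ENNReal.iSup_add_iSup_of_monotone]
  · exact iSup_mono fun n => le_iInf₂ fun i hi =>
      add_le_add (iInf₂_le i hi) (iInf₂_le i hi)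
  · exact fun m n hmn => le_iInf₂ fun i hi => iInf₂_le i (hmn.trans hi)
  · exact fun m n hmn => le_iInf₂ fun i hi => iInf₂_le i (hmn.trans hi)

theorem totalVariation_le_liminf {s : TVVariant}
    {v : ℕ → EuclideanSpace ℝ (Fin d) → EuclideanSpace ℝ (Fin d)}
    {g : EuclideanSpace ℝ (Fin d) → EuclideanSpace ℝ (Fin d)}
    (hv : ∀ n, Integrable (v n) (volume.restrict Ω)) (hg : Integrable g (volume.restrict Ω))
    (h : ∀ (i : Fin d) (ψ : EuclideanSpace ℝ (Fin d) → ℝ), IsTestFunction Ω ψ →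
        Tendsto (fun n => ∫ x in Ω, v n x i * ψ x) atTop (𝓝 (∫ x in Ω, g x i * ψ x))) :
    totalVariation s Ω g ≤ liminf (fun n => totalVariation s Ω (v n)) atTop := by
  refine iSup₂_le fun φ hφ => ?_
  have hexp : ∀ u : EuclideanSpace ℝ (Fin d) → EuclideanSpace ℝ (Fin d),
      Integrable u (volume.restrict Ω) →
      ∫ x in Ω, ∑ i, u x i * ∑ j, partialDeriv j (φ i j) x =
        ∑ i, ∑ j, ∫ x in Ω, u x i * partialDeriv j (φ i j) x := by
    intro u hu
    have hint : ∀ i j, Integrable (fun x => u x i * partialDeriv j (φ i j) x)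
        (volume.restrict Ω) := by
      intro i j
      have ht := (hφ.1 i j).partialDeriv j
      obtain ⟨A, hA⟩ := ht.exists_bound
      exact ((EuclideanSpace.proj (𝕜 := ℝ) i).integrable_comp hu).mul_bdd (c := A)
        ht.1.continuous.aestronglyMeasurable (ae_of_all _ hA)
    simp_rw [Finset.mul_sum]
    rw [integral_finsetSum _ fun i _ => integrable_finsetSum _ fun j _ => hint i j]
    refine Finset.sum_congr rfl fun i _ => ?_
    rw [integral_finsetSum _ fun j _ => hint i j]
  have hlim : Tendsto
      (fun n => ENNReal.ofReal (∫ x in Ω, ∑ i, v n x i * ∑ j, partialDeriv j (φ i j) x)) atTop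
      (𝓝 (ENNReal.ofReal (∫ x in Ω, ∑ i, g x i * ∑ j, partialDeriv j (φ i j) x))) := by
    refine ENNReal.tendsto_ofReal ?_
    simp_rw [fun n => hexp (v n) (hv n), hexp g hg]
    exact tendsto_finsetSum _ fun i _ => tendsto_finsetSum _ fun j _ =>
      h i _ ((hφ.1 i j).partialDeriv j)
  rw [← hlim.liminf_eq]
  exact liminf_le_liminf (Eventually.of_forall fun n => le_iSup₂_of_le φ hφ le_rfl)

theorem lpTVEnergy_le_liminf {p : ℕ} (hp : p ≠ 0) {s : TVVariant} {α : ℝ}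
    {ut : EuclideanSpace ℝ (Fin d) → ℝ} (hut : AEStronglyMeasurable ut (volume.restrict Ω))
    (hGm : AEStronglyMeasurable G (volume.restrict Ω))
    {v : ℕ → EuclideanSpace ℝ (Fin d) → EuclideanSpace ℝ (Fin d)}
    {g : EuclideanSpace ℝ (Fin d) → EuclideanSpace ℝ (Fin d)}
    (hv : ∀ n, Integrable (v n) (volume.restrict Ω)) (hg : Integrable g (volume.restrict Ω))
    (hae : ∀ᵐ x ∂(volume.restrict Ω), Tendsto (fun n => v n x) atTop (𝓝 (g x)))
    (h : ∀ (i : Fin d) (ψ : EuclideanSpace ℝ (Fin d) → ℝ), IsTestFunction Ω ψ →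
        Tendsto (fun n => ∫ x in Ω, v n x i * ψ x) atTop (𝓝 (∫ x in Ω, g x i * ψ x))) :
    lpTVEnergy p s α Ω ut G g ≤ liminf (fun n => lpTVEnergy p s α Ω ut G (v n)) atTop := by
  have hdata : ∫⁻ x in Ω, ‖ut x + inner ℝ (G x) (g x)‖ₑ ^ p ≤
      liminf (fun n => ∫⁻ x in Ω, ‖ut x + inner ℝ (G x) (v n x)‖ₑ ^ p) atTop := by
    refine le_trans (lintegral_mono_ae ?_) (lintegral_liminf_le' fun n =>
      (hut.add (hGm.inner (hv n).1)).enorm.pow_const p)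
    filter_upwards [hae] with x hx
    have hc : Continuous fun y : EuclideanSpace ℝ (Fin d) => ‖ut x + inner ℝ (G x) y‖ₑ ^ p := by
      fun_prop
    exact ((hc.tendsto _).comp hx).liminf_eq.ge
  refine le_trans ?_ (liminf_add_liminf_le_ennreal _ _)
  unfold lpTVEnergy
  simp only [div_eq_mul_inv, mul_comm _ (p : ℝ≥0∞)⁻¹]
  rw [ENNReal.liminf_const_mul_of_ne_top (by simpa using hp),
    ENNReal.liminf_const_mul_of_ne_top ENNReal.ofReal_ne_top]
  gcongr
  exact totalVariation_le_liminf hv hg h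

end

/-! ### Existence of a minimizer -/

theorem totalVariation_zero {d : ℕ} (s : TVVariant) (Ω : Set (EuclideanSpace ℝ (Fin d))) :
    totalVariation s Ω 0 = 0 := by
  simp [totalVariation]

theorem memBV_zero {d : ℕ} (Ω : Set (EuclideanSpace ℝ (Fin d))) : MemBV Ω 0 :=
  ⟨MemLp.zero, by simp [totalVariation_zero]⟩

theorem lpTVEnergy_zero_lt_top {d p : ℕ} (hp : p ≠ 0) (s : TVVariant) (α : ℝ)
    {Ω : Set (EuclideanSpace ℝ (Fin d))} {ut : EuclideanSpace ℝ (Fin d) → ℝ}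
    (hut : MemLp ut (p : ℝ≥0∞) (volume.restrict Ω))
    (G : EuclideanSpace ℝ (Fin d) → EuclideanSpace ℝ (Fin d)) :
    lpTVEnergy p s α Ω ut G 0 < ⊤ := by
  have h1 := lintegral_rpow_enorm_lt_top_of_eLpNorm_lt_top (by simpa using hp)
    (ENNReal.natCast_ne_top p) hut.2
  simp only [ENNReal.toReal_natCast, ENNReal.rpow_natCast] at h1
  rw [lpTVEnergy, totalVariation_zero, mul_zero, add_zero]
  refine ENNReal.div_lt_top ?_ (by simpa using hp)
  simpa using h1.ne

/-- Fields of energy at most `E` lie in a fixed ball of `BV(Ω)^d`, after a modification on a null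
set of `Ω` and outside `Ω`. -/
theorem exists_isBVBounded_of_lpTVEnergy_le {d p : ℕ} (hp : p ≠ 0) (s : TVVariant) {α : ℝ}
    (hα : 0 < α) {Ω : Set (EuclideanSpace ℝ (Fin d))} (hΩo : IsOpen Ω) (hΩc : IsConnected Ω)
    (hΩb : Bornology.IsBounded Ω) (hcone : ConeCondition Ω) {ut : EuclideanSpace ℝ (Fin d) → ℝ}
    (hut : Integrable ut (volume.restrict Ω))
    {G : EuclideanSpace ℝ (Fin d) → EuclideanSpace ℝ (Fin d)}
    (hGm : AEStronglyMeasurable G (volume.restrict Ω))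
    (hG : ∀ i : Fin d, MemLp (fun x => G x i) ⊤ (volume.restrict Ω))
    (hli : LinearIndependent ℝ
      (fun i : Fin d => ((hG i).toLp (fun x => G x i) : Lp ℝ ⊤ (volume.restrict Ω))))
    {E : ℝ≥0∞} (hE : E ≠ ⊤) :
    ∃ C M : ℝ, 0 ≤ C ∧ 0 ≤ M ∧ ∀ w, MemBV Ω w → lpTVEnergy p s α Ω ut G w ≤ E →
      ∃ v, IsBVBounded Ω C M v ∧ v =ᵐ[volume.restrict Ω] w := by
  have hΩfin : volume Ω ≠ ⊤ := hΩb.measure_lt_top.ne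
  have hα0 : ENNReal.ofReal α ≠ 0 := (ENNReal.ofReal_pos.2 hα).ne'
  have hp0 : (p : ℝ≥0∞) ≠ 0 := by simpa using hp
  have hB : E / ENNReal.ofReal α ≠ ⊤ := ENNReal.div_ne_top hE hα0
  set M := (E / ENNReal.ofReal α).toReal with hM
  have hA : volume Ω + E * p ≠ ⊤ := by finiteness
  obtain ⟨C, hC, hcoer⟩ :=
    exists_lintegral_le_of_dataTerm_le hΩo hΩc hΩb hcone hut hGm hG hli hA M
  refine ⟨C.toReal, M, ENNReal.toReal_nonneg, ENNReal.toReal_nonneg, fun w hw hwE => ?_⟩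
  obtain ⟨v, hvm, hvi, hvw, hvΩ⟩ := hw.exists_measurable_integrable hΩo
  rw [← lpTVEnergy_congr hvw, lpTVEnergy] at hwE
  have hTV : totalVariation .isotropic Ω v ≤ ENNReal.ofReal M := by
    rw [hM, ENNReal.ofReal_toReal hB]
    refine (totalVariation_isotropic_le s v).trans ?_
    rw [ENNReal.le_div_iff_mul_le (Or.inl hα0) (Or.inl ENNReal.ofReal_ne_top), mul_comm]
    exact le_add_self.trans hwE
  have hvar := hasVariationBound_apply_of_totalVariation_le ENNReal.toReal_nonneg hTV
  have hdata : ∫⁻ x in Ω, ‖ut x + inner ℝ (G x) (v x)‖ₑ ≤ volume Ω + E * p := by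
    have h1 : ∫⁻ x in Ω, ‖ut x + inner ℝ (G x) (v x)‖ₑ ^ p ≤ E * p := by
      rw [← ENNReal.div_le_iff_le_mul (Or.inl hp0) (Or.inl (ENNReal.natCast_ne_top p))]
      exact le_self_add.trans hwE
    calc ∫⁻ x in Ω, ‖ut x + inner ℝ (G x) (v x)‖ₑ
        ≤ ∫⁻ x in Ω, (1 + ‖ut x + inner ℝ (G x) (v x)‖ₑ ^ p) := by
          refine lintegral_mono fun x => ?_
          -- As `p ≥ 1`, `a ≤ 1 + a ^ p`; this passes from `L^p` to `L¹` on the bounded set `Ω`.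
          rcases le_total ‖ut x + inner ℝ (G x) (v x)‖ₑ 1 with h | h
          · exact h.trans le_self_add
          · exact (le_self_pow₀ h hp).trans le_add_self
      _ = volume Ω + ∫⁻ x in Ω, ‖ut x + inner ℝ (G x) (v x)‖ₑ ^ p := by
          rw [lintegral_add_left measurable_const, setLIntegral_const, one_mul]
      _ ≤ _ := by gcongr
  refine ⟨v, ⟨hvm, ?_, hvar⟩, hvw⟩
  rw [hvΩ, ENNReal.ofReal_toReal hC]
  exact hcoer v hvm hvi hvar hdata

/-- The energy has a minimizer for every integer `p ≥ 1`, and for every bounded field `G` with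
linearly independent components, not only for a gradient. -/
theorem exists_memBV_forall_lpTVEnergy_le {d p : ℕ} (hp0 : p ≠ 0) (s : TVVariant) {α : ℝ}
    (hα : 0 < α) {Ω : Set (EuclideanSpace ℝ (Fin d))} (hΩo : IsOpen Ω) (hΩc : IsConnected Ω)
    (hΩb : Bornology.IsBounded Ω) (hne : Ωᶜ.Nonempty) (hΩcone : ConeCondition Ω)
    {ut : EuclideanSpace ℝ (Fin d) → ℝ} (hut : MemLp ut (p : ℝ≥0∞) (volume.restrict Ω))
    {G : EuclideanSpace ℝ (Fin d) → EuclideanSpace ℝ (Fin d)}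
    (hGm : AEStronglyMeasurable G (volume.restrict Ω))
    (hG : ∀ i : Fin d, MemLp (fun x => G x i) ⊤ (volume.restrict Ω))
    (hli : LinearIndependent ℝ
      (fun i : Fin d => ((hG i).toLp (fun x => G x i) : Lp ℝ ⊤ (volume.restrict Ω)))) :
    ∃ v, MemBV Ω v ∧
      ∀ w, MemBV Ω w → lpTVEnergy p s α Ω ut G v ≤ lpTVEnergy p s α Ω ut G w := by
  have : IsFiniteMeasure (volume.restrict Ω) := ⟨by simpa using hΩb.measure_lt_top⟩
  have hut1 : Integrable ut (volume.restrict Ω) :=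
    hut.integrable (by exact_mod_cast Nat.one_le_iff_ne_zero.2 hp0)
  obtain ⟨e, -, he, heS⟩ := exists_seq_tendsto_sInf
    (S := lpTVEnergy p s α Ω ut G '' {w | MemBV Ω w})
    ⟨_, 0, memBV_zero Ω, rfl⟩ (OrderBot.bddBelow _)
  set m := sInf (lpTVEnergy p s α Ω ut G '' {w | MemBV Ω w}) with hm
  have hmle : ∀ w, MemBV Ω w → m ≤ lpTVEnergy p s α Ω ut G w :=
    fun w hw => sInf_le ⟨w, hw, rfl⟩
  have hmfin : m ≠ ⊤ := ((hmle 0 (memBV_zero Ω)).trans_lt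
    (lpTVEnergy_zero_lt_top hp0 s α hut G)).ne
  -- Dropping finitely many terms makes the energies uniformly bounded.
  obtain ⟨N, hN⟩ := eventually_atTop.1
    (he.eventually_le_const (ENNReal.lt_add_right hmfin one_ne_zero))
  obtain ⟨C, M, hC, hM, hbdd⟩ := exists_isBVBounded_of_lpTVEnergy_le hp0 s hα hΩo hΩc
    hΩb hΩcone hut1 hGm hG hli (E := m + 1) (by finiteness)
  have hex : ∀ n, ∃ v, IsBVBounded Ω C M v ∧
      lpTVEnergy p s α Ω ut G v = e (n + N) := by
    intro n
    obtain ⟨w, hw, hwe⟩ := heS (n + N)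
    obtain ⟨v, hv, hvw⟩ := hbdd w hw (hwe ▸ hN _ (Nat.le_add_left _ _))
    exact ⟨v, hv, (lpTVEnergy_congr hvw).trans hwe⟩
  choose v hv hve using hex
  obtain ⟨φ, g, hφ, hgm, hgC, hae, hweak⟩ :=
    exists_subseq_tendsto_of_isBVBounded hΩo hΩb hne hC hM hv
  have hgi : Integrable g (volume.restrict Ω) :=
    ⟨hgm.aestronglyMeasurable, hgC.trans_lt ENNReal.ofReal_lt_top⟩
  have hvi : ∀ n, Integrable (v (φ n)) (volume.restrict Ω) := fun n =>
    (hv (φ n)).integrable.integrableOn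
  have hlim : Tendsto (fun n => lpTVEnergy p s α Ω ut G (v (φ n))) atTop (𝓝 m) := by
    simp_rw [hve]
    exact he.comp ((tendsto_add_atTop_nat N).comp hφ.tendsto_atTop)
  have hgE : lpTVEnergy p s α Ω ut G g ≤ m := by
    rw [← hlim.liminf_eq]
    exact lpTVEnergy_le_liminf hp0 hut.1 hGm hvi hgi hae hweak
  refine ⟨g, ⟨memLp_one_iff_integrable.2 hgi, ?_⟩, fun w hw => hgE.trans (hmle w hw)⟩
  -- The energy of `g` is finite, hence so is its total variation.
  refine (totalVariation_isotropic_le s g).trans_lt (lt_top_iff_ne_top.2 fun htop => ?_)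
  refine hmfin (top_le_iff.1 (le_trans ?_ hgE))
  rw [lpTVEnergy, htop, ENNReal.mul_top (ENNReal.ofReal_pos.2 hα).ne', add_top]

end OpticalFlow

theorem mainTheorem1 {d : ℕ} (hd : 1 ≤ d)
    (p : ℕ) (hp : p = 1 ∨ (p = 2 ∧ d ≤ 2))
    (s : OpticalFlow.TVVariant) (α : ℝ) (hα : 0 < α)
    (Ω : Set (EuclideanSpace ℝ (Fin d)))
    (hΩo : IsOpen Ω) (hΩc : IsConnected Ω) (hΩb : Bornology.IsBounded Ω)
    (hΩcone : OpticalFlow.ConeCondition Ω)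
    (ut : EuclideanSpace ℝ (Fin d) → ℝ) (hut : MemLp ut (p : ℝ≥0∞) (volume.restrict Ω))
    (u : EuclideanSpace ℝ (Fin d) → ℝ)
    (G : EuclideanSpace ℝ (Fin d) → EuclideanSpace ℝ (Fin d))
    (hu : OpticalFlow.HasWeakGradient Ω u G)
    (hG : ∀ i : Fin d, MemLp (fun x => G x i) ⊤ (volume.restrict Ω))
    (hli : LinearIndependent ℝ
      (fun i : Fin d => ((hG i).toLp (fun x => G x i) : Lp ℝ ⊤ (volume.restrict Ω)))) :
    ∃ v : EuclideanSpace ℝ (Fin d) → EuclideanSpace ℝ (Fin d),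
      OpticalFlow.MemBV Ω v ∧
      ∀ w : EuclideanSpace ℝ (Fin d) → EuclideanSpace ℝ (Fin d), OpticalFlow.MemBV Ω w →
        OpticalFlow.lpTVEnergy p s α Ω ut G v ≤ OpticalFlow.lpTVEnergy p s α Ω ut G w := by
  have : Nonempty (Fin d) := ⟨⟨0, hd⟩⟩
  have hne : Ωᶜ.Nonempty := by
    rw [nonempty_compl]
    rintro rfl
    exact NormedSpace.unbounded_univ ℝ (EuclideanSpace ℝ (Fin d)) hΩb
  exact OpticalFlow.exists_memBV_forall_lpTVEnergy_le (by omega) s hα hΩo hΩc hΩb hne hΩcone hut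
    hu.2.1.aestronglyMeasurable hG hli
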